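/- Let ${\mathsf K},{\mathsf U},{\mathsf S}$ be integers with $1\le {\mathsf U}<{\mathsf K}$ and $1\le {\mathsf S}\le {\mathsf K}$, let $\mathbb{F}_{\mathsf q}$ be any finite field, write $[{\mathsf K}]=\{1,\dots,{\mathsf K}\}$ and $\binom{[{\mathsf K}]}{{\mathsf S}}$ for the family of ${\mathsf S}$-element subsets of $[{\mathsf K}]$, and let all entropies be in base ${\mathsf q}$. The $({\mathsf K},{\mathsf U},{\mathsf S})$ information-theoretic secure aggregation problem with uncoded groupwise keys is the following. For an input length ${\mathsf L}\ge 1$, a *scheme* consists of random variables with finite alphabets on a common probability space: - inputs $W_1,\dots,W_{\mathsf K}$, each uniform on $\mathbb{F}_{\mathsf q}^{\mathsf L}$; - keys $Z_{\mathcal V}$, ${\mathcal V}\in\binom{[{\mathsf K}]}{{\mathsf S}}$, such that all keys and inputs are mutually independent, i.e. $H\big((Z_{\mathcal V})_{\mathcal V},(W_k)_k\big)=\sum_{\mathcal V}H(Z_{\mathcal V})+\sum_k H(W_k)$; put $Z_k:=(Z_{\mathcal V}: k\in{\mathcal V})$; - first-round messages $X_k$, $k\in[{\mathsf K}]$, with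 $H(X_k\mid W_k,Z_k)=0$; - for every ${\mathcal U}_1\subseteq[{\mathsf K}]$ with $|{\mathcal U}_1|\ge{\mathsf U}$ and every $k\in{\mathcal U}_1$, a second-round message $Y_k^{{\mathcal U}_1}$ with $H(Y_k^{{\mathcal U}_1}\mid W_k,Z_k)=0$; which satisfy - decodability: $H\big(\sum_{k\in{\mathcal U}_1}W_k \,\big|\, (X_k)_{k\in{\mathcal U}_1},(Y_k^{{\mathcal U}_1})_{k\in{\mathcal U}_2}\big)=0$ for all ${\mathcal U}_2\subseteq{\mathcal U}_1\subseteq[{\mathsf K}]$ with $|{\mathcal U}_2|\ge{\mathsf U}$; - security: $I\big(W_1,\dots,W_{\mathsf K};\, X_1,\dots,X_{\mathsf K},(Y_k^{{\mathcal U}_1})_{k\in{\mathcal U}_1} \,\big|\, \sum_{k\in{\mathcal U}_1}W_k\big)=0$ for all ${\mathcal U}_1\subseteq[{\mathsf K}]$ with $|{\mathcal U}_1|\ge{\mathsf U}$. The rates of a scheme are ${\mathsf R}_1=\max_{k\in[{\mathsf K}]}H(X_k)/{\mathsf L}$ and ${\mathsf R}_2=\max_{|{\mathcal U}_1|\ge{\mathsf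 U}}\max_{k\in{\mathcal U}_1}H(Y_k^{{\mathcal U}_1})/{\mathsf L}$. A pair $({\mathsf R}_1,{\mathsf R}_2)$ is achievable if it is the pair of rates of some scheme for some ${\mathsf L}\ge1$, and the capacity region ${\mathcal R}^\star\subseteq\mathbb{R}^2$ is the closure of the set of achievable pairs. **Theorem.** If ${\mathsf S}=1$, secure aggregation is impossible: no scheme exists for any ${\mathsf L}\ge 1$. If ${\mathsf S}\ge2$, then $$ {\mathcal R}^{\star}=\left\{({\mathsf R}_1,{\mathsf R}_2)\in\mathbb{R}^2:\ {\mathsf R}_1\ge\frac{\binom{{\mathsf K}-1}{{\mathsf S}-1}}{\binom{{\mathsf K}-1}{{\mathsf S}-1}-\binom{{\mathsf K}-1-{\mathsf U}}{{\mathsf S}-1}},\quad {\mathsf R}_2\ge\frac1{\mathsf U}\right\}, $$ where $\binom{n}{m}=0$ for $n<m$. -/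

import Mathlib

namespace SecureAggregation

open MeasureTheory

universe u

section Entropy

variable {Ω α β γ : Type*} [MeasurableSpace Ω] [Fintype α] [Fintype β] [Fintype γ]

/-- Shannon entropy, in base `b`, of a random variable `A` with finite alphabet:
`-∑ a, P(A = a) log_b P(A = a)`. -/
noncomputable def entropy (b : ℝ) (μ : Measure Ω) (A : Ω → α) : ℝ :=
  ∑ a, Real.negMulLog (μ.real (A ⁻¹' {a})) / Real.log b

/-- Conditional entropy `H(A | B) = H(A, B) - H(B)`. -/
noncomputable def condEntropy (b : ℝ) (μ : Measure Ω) (A : Ω → α) (B : Ω → β) : ℝ :=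
  entropy b μ (fun ω => (A ω, B ω)) - entropy b μ B

/-- Conditional mutual information `I(A ; B | C) = H(A | C) - H(A | B, C)`. -/
noncomputable def condMutualInfo (b : ℝ) (μ : Measure Ω)
    (A : Ω → α) (B : Ω → β) (C : Ω → γ) : ℝ :=
  condEntropy b μ A C - condEntropy b μ A (fun ω => (B ω, C ω))

end Entropy

/-- The groups of exactly `S` users among the `K` users. -/
abbrev UserGroup (K S : ℕ) : Type := {V : Finset (Fin K) // V.card = S}

/-- The random variables of a two-round aggregation protocol with `K` users, groups of size `S`
and input vectors of `L` symbols of `F`, all on one probability space. The alphabets of the keys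
and of the messages are arbitrary finite sets. `Y U₁ k` is the second-round message of user `k`
when `U₁` is the set of users surviving the first round; it is meaningful only for `k ∈ U₁`, and
no constraint or rate below refers to its other values. -/
structure Scheme (K S L : ℕ) (F : Type u) where
  Ω : Type u
  [measΩ : MeasurableSpace Ω]
  μ : Measure Ω
  [probμ : IsProbabilityMeasure μ]
  Key : UserGroup K S → Type u
  [fintypeKey : ∀ V, Fintype (Key V)]
  Msg₁ : Fin K → Type u
  [fintypeMsg₁ : ∀ k, Fintype (Msg₁ k)]
  Msg₂ : Finset (Fin K) → Fin K → Type u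
  [fintypeMsg₂ : ∀ U₁ k, Fintype (Msg₂ U₁ k)]
  /-- the input vectors -/
  W : Fin K → Ω → (Fin L → F)
  /-- the groupwise keys -/
  Z : (V : UserGroup K S) → Ω → Key V
  /-- the first-round messages -/
  X : (k : Fin K) → Ω → Msg₁ k
  /-- the second-round messages -/
  Y : (U₁ : Finset (Fin K)) → (k : Fin K) → Ω → Msg₂ U₁ k
  measurable_W : ∀ k, Measurable[measΩ, ⊤] (W k)
  measurable_Z : ∀ V, Measurable[measΩ, ⊤] (Z V)
  measurable_X : ∀ k, Measurable[measΩ, ⊤] (X k)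
  measurable_Y : ∀ U₁ k, Measurable[measΩ, ⊤] (Y U₁ k)

attribute [instance] Scheme.measΩ Scheme.probμ Scheme.fintypeKey Scheme.fintypeMsg₁
  Scheme.fintypeMsg₂

namespace Scheme

variable {K S L : ℕ} {F : Type u} [Field F] [Fintype F] (𝒮 : Scheme K S L F)

/-- Entropy in base `q = |F|`. -/
noncomputable def H {α : Type*} [Fintype α] (A : 𝒮.Ω → α) : ℝ :=
  entropy (Fintype.card F) 𝒮.μ A

/-- Conditional entropy in base `q = |F|`. -/
noncomputable def condH {α β : Type*} [Fintype α] [Fintype β]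
    (A : 𝒮.Ω → α) (B : 𝒮.Ω → β) : ℝ :=
  condEntropy (Fintype.card F) 𝒮.μ A B

/-- Conditional mutual information in base `q = |F|`. -/
noncomputable def condI {α β γ : Type*} [Fintype α] [Fintype β] [Fintype γ]
    (A : 𝒮.Ω → α) (B : 𝒮.Ω → β) (C : 𝒮.Ω → γ) : ℝ :=
  condMutualInfo (Fintype.card F) 𝒮.μ A B C

/-- The tuple `Z_k` of all keys held by user `k`. -/
def userKeys (k : Fin K) (ω : 𝒮.Ω) (V : {V : UserGroup K S // k ∈ V.1}) : 𝒮.Key V.1 :=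
  𝒮.Z V.1 ω

/-- The sum of the input vectors of the users in `U₁`. -/
def sumInputs (U₁ : Finset (Fin K)) (ω : 𝒮.Ω) : Fin L → F :=
  ∑ k ∈ U₁, 𝒮.W k ω

/-- Each `W_k` consists of `L` i.i.d. uniform symbols of `F`, i.e. is uniform on `F ^ L`. -/
def UniformInputs : Prop :=
  ∀ (k : Fin K) (w : Fin L → F),
    𝒮.μ.real (𝒮.W k ⁻¹' {w}) = 1 / (Fintype.card F : ℝ) ^ L

/-- All keys and all input vectors are mutually independent. -/
def IndependentKeys : Prop :=
  𝒮.H (fun ω => ((fun V => 𝒮.Z V ω), (fun k => 𝒮.W k ω)))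
    = ∑ V, 𝒮.H (𝒮.Z V) + ∑ k, 𝒮.H (𝒮.W k)

/-- `X_k` is determined by `(W_k, Z_k)`. -/
def FirstRoundEncoding : Prop :=
  ∀ k : Fin K, 𝒮.condH (𝒮.X k) (fun ω => (𝒮.W k ω, 𝒮.userKeys k ω)) = 0

/-- For each possible surviving set `U₁`, the message of `k ∈ U₁` is determined by
`(W_k, Z_k)`. -/
def SecondRoundEncoding (U : ℕ) : Prop :=
  ∀ U₁ : Finset (Fin K), U ≤ U₁.card → ∀ k ∈ U₁,
    𝒮.condH (𝒮.Y U₁ k) (fun ω => (𝒮.W k ω, 𝒮.userKeys k ω)) = 0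

/-- The server recovers the sum over `U₁` from the first-round messages of `U₁` and the
second-round messages of `U₂`. -/
def Decodable (U : ℕ) : Prop :=
  ∀ U₁ U₂ : Finset (Fin K), U₂ ⊆ U₁ → U ≤ U₂.card →
    𝒮.condH (𝒮.sumInputs U₁)
      (fun ω => ((fun k : U₁ => 𝒮.X k ω), (fun k : U₂ => 𝒮.Y U₁ k ω))) = 0

/-- All messages together reveal nothing about the inputs beyond the sum over `U₁`. -/
def Secure (U : ℕ) : Prop :=
  ∀ U₁ : Finset (Fin K), U ≤ U₁.card →
    𝒮.condI (fun ω k => 𝒮.W k ω)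
      (fun ω => ((fun k => 𝒮.X k ω), (fun k : U₁ => 𝒮.Y U₁ k ω)))
      (𝒮.sumInputs U₁) = 0

/-- The scheme solves the secure aggregation problem with uncoded groupwise keys in which at
least `U` users survive. -/
structure IsSecureAggregation (U : ℕ) : Prop where
  uniform : 𝒮.UniformInputs
  keys : 𝒮.IndependentKeys
  encode₁ : 𝒮.FirstRoundEncoding
  encode₂ : 𝒮.SecondRoundEncoding U
  decode : 𝒮.Decodable U
  secure : 𝒮.Secure U

/-- First-round rate: the maximum over the users `k` of `H(X_k) / L`. -/
noncomputable def rate₁ : ℝ :=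
  ⨆ k : Fin K, 𝒮.H (𝒮.X k) / L

/-- Second-round rate: the maximum of `H(Y_k^{U₁}) / L` over the sets `U₁` of at least `U` users
and the users `k ∈ U₁`. -/
noncomputable def rate₂ (U : ℕ) : ℝ :=
  ⨆ p : {p : Finset (Fin K) × Fin K // U ≤ p.1.card ∧ p.2 ∈ p.1},
    𝒮.H (𝒮.Y p.1.1 p.1.2) / L

end Scheme

/-- Secure aggregation is possible, for some input length `L ≥ 1`. -/
def Possible (K U S : ℕ) (F : Type u) [Field F] [Fintype F] : Prop :=
  ∃ L : ℕ, 0 < L ∧ ∃ 𝒮 : Scheme K S L F, 𝒮.IsSecureAggregation U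

/-- `R = (R₁, R₂)` is the rate tuple of some scheme, for some input length `L ≥ 1`. -/
def Achievable (K U S : ℕ) (F : Type u) [Field F] [Fintype F] (R : ℝ × ℝ) : Prop :=
  ∃ L : ℕ, 0 < L ∧ ∃ 𝒮 : Scheme K S L F,
    𝒮.IsSecureAggregation U ∧ R.1 = 𝒮.rate₁ ∧ R.2 = 𝒮.rate₂ U

/-- The capacity region: the closure of the set of achievable rate tuples. -/
def capacityRegion (K U S : ℕ) (F : Type u) [Field F] [Fintype F] : Set (ℝ × ℝ) :=
  closure {R | Achievable K U S F R}

end SecureAggregation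

/-!
Converse: let `k` be a user and `U₂` a set of `U` other users. Given everything that does not
involve `k`, the first-round message `X k` and the keys that `k` shares with `U₂` suffice to decode
the sum over `U₂ ∪ {k}`; by independence they already determine `W k`, whereas security makes `X k`
alone independent of `W k`. Hence these keys carry `L` symbols of information, and Shearer's
inequality, averaging over `U₂`, turns this into a lower bound on `H(X k)`. In the second round, a
sum of inputs is independent of the first-round messages as long as more users may survive, so the
`U` second-round messages have to supply all `L` symbols.

Achievability: put vectors `v k` in general position in a space of dimension `K - 1`, over a large
extension field. An input is a `U`-tuple of alternating forms of degree `S - 1` that vanish on a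
fixed subspace of dimension `K - 1 - U`; these forms make up a space of dimension
`C(K - 1, S - 1) - C(K - 1 - U, S - 1)`. In the first round, user `k` sends the values of its forms
on the families `(v i)`, `i ∈ V \ {k}`, masked with a part of the key of each group `V`. Removing
the masks known to `j` reveals the contraction by `v j` of the sum of the forms, and a generic
linear image of it, a `U`-th of the input in size, is sent in the second round: any `U` such images
determine the sum. Random padding raises the two rates at will.
-/

namespace SecureAggregation

open MeasureTheory Module

universe u

/-! ### Entropy inequalities -/

section EntropyInequalities

/-- Gibbs' inequality, for a subprobability `q` relative to `p`. -/
lemma sum_mul_log_le_sum_mul_log {ι : Type*} {s : Finset ι} {p q : ι → ℝ}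
    (hp : ∀ i ∈ s, 0 ≤ p i) (hq : ∀ i ∈ s, 0 ≤ q i) (hpq : ∀ i ∈ s, p i ≠ 0 → q i ≠ 0)
    (hsum : ∑ i ∈ s, q i ≤ ∑ i ∈ s, p i) :
    ∑ i ∈ s, p i * Real.log (q i) ≤ ∑ i ∈ s, p i * Real.log (p i) := by
  have pointwise : ∀ i ∈ s, p i * Real.log (q i) - p i * Real.log (p i) ≤ q i - p i := by
    intro i hi
    rcases (hp i hi).eq_or_lt with hpi | hpi
    · simp [← hpi, hq i hi]
    have hqi : 0 < q i := (hq i hi).lt_of_ne' (hpq i hi hpi.ne')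
    calc p i * Real.log (q i) - p i * Real.log (p i) = p i * Real.log (q i / p i) := by
          rw [Real.log_div hqi.ne' hpi.ne']; ring
      _ ≤ p i * (q i / p i - 1) := by gcongr; exact Real.log_le_sub_one_of_pos (div_pos hqi hpi)
      _ = q i - p i := by field_simp
  have := Finset.sum_le_sum pointwise
  simp only [Finset.sum_sub_distrib] at this
  linarith

variable {Ω α β γ δ : Type*} [MeasurableSpace Ω] {μ : Measure Ω}

lemma measureReal_preimage_singleton_le_comp [IsFiniteMeasure μ] (A : Ω → α) (f : α → γ) (a : α) :
    μ.real (A ⁻¹' {a}) ≤ μ.real ((fun ω => f (A ω)) ⁻¹' {f a}) :=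
  measureReal_mono fun _ hω => congrArg f hω

lemma marginals_ne_zero_of_measureReal_ne_zero [IsFiniteMeasure μ] {A : Ω → α} {B : Ω → β}
    {f : α → γ} {g : β → γ} (hfg : ∀ ω, f (A ω) = g (B ω)) {x : α × β}
    (hx : μ.real ((fun ω => (A ω, B ω)) ⁻¹' {x}) ≠ 0) :
    μ.real (A ⁻¹' {x.1}) ≠ 0 ∧ μ.real (B ⁻¹' {x.2}) ≠ 0 ∧
      μ.real ((fun ω => f (A ω)) ⁻¹' {f x.1}) ≠ 0 ∧ f x.1 = g x.2 := by
  have hpos := measureReal_nonneg.lt_of_ne' hx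
  refine ⟨(hpos.trans_le (measureReal_preimage_singleton_le_comp _ Prod.fst x)).ne',
    (hpos.trans_le (measureReal_preimage_singleton_le_comp _ Prod.snd x)).ne',
    (hpos.trans_le (measureReal_preimage_singleton_le_comp _ (fun y => f y.1) x)).ne', ?_⟩
  obtain ⟨ω, rfl⟩ : ((fun ω => (A ω, B ω)) ⁻¹' {x}).Nonempty :=
    Set.nonempty_iff_ne_empty.2 fun h => hx (by rw [h, measureReal_empty])
  exact hfg ω

variable [IsProbabilityMeasure μ] {b : ℝ}

lemma entropy_const [Fintype α] (a : α) : entropy b μ (fun _ : Ω => a) = 0 := by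
  classical
  refine Finset.sum_eq_zero fun c _ => ?_
  by_cases h : a = c <;> simp [h]

variable [Fintype α] [MeasurableSpace α] [MeasurableSingletonClass α]
  [Fintype β] [MeasurableSpace β] [MeasurableSingletonClass β]

lemma sum_measureReal_preimage_singleton_eq_one {A : Ω → α} (hA : Measurable A) :
    ∑ a, μ.real (A ⁻¹' {a}) = 1 := by
  rw [sum_measureReal_preimage_singleton _ fun a _ => hA (measurableSet_singleton a)]
  simp

lemma entropy_comp_eq_sum {A : Ω → α} (hA : Measurable A) [Fintype γ] (f : α → γ) :
    entropy b μ (fun ω => f (A ω)) =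
      (∑ a, μ.real (A ⁻¹' {a}) * -Real.log (μ.real ((fun ω => f (A ω)) ⁻¹' {f a})))
        / Real.log b := by
  classical
  rw [entropy, ← Finset.sum_div,
    ← Finset.sum_fiberwise_of_maps_to (t := Finset.univ) (g := f) (fun _ _ => Finset.mem_univ _)]
  congr 1
  refine Finset.sum_congr rfl fun c _ => ?_
  have hfiber : μ.real ((fun ω => f (A ω)) ⁻¹' {c}) =
      ∑ a with f a = c, μ.real (A ⁻¹' {a}) := by
    rw [sum_measureReal_preimage_singleton _ fun a _ => hA (measurableSet_singleton a)]
    congr 1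
    ext ω
    simp
  rw [Finset.sum_congr rfl fun a ha => by rw [(Finset.mem_filter.1 ha).2], ← Finset.sum_mul,
    ← hfiber, Real.negMulLog]
  ring

lemma entropy_comp_le (hb : 1 ≤ b) {A : Ω → α} (hA : Measurable A) [Fintype γ] (f : α → γ) :
    entropy b μ (fun ω => f (A ω)) ≤ entropy b μ A := by
  rw [entropy_comp_eq_sum hA f, entropy_comp_eq_sum hA fun a => a]
  refine div_le_div_of_nonneg_right (Finset.sum_le_sum fun a _ => ?_) (Real.log_nonneg hb)
  rcases (measureReal_nonneg (μ := μ) (s := A ⁻¹' {a})).eq_or_lt with h0 | h0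
  · simp [← h0]
  · exact mul_le_mul_of_nonneg_left (neg_le_neg (Real.log_le_log h0
      (measureReal_preimage_singleton_le_comp A f a))) h0.le

lemma entropy_le_log_card (hb : 1 ≤ b) {A : Ω → α} (hA : Measurable A) :
    entropy b μ A ≤ Real.log (Fintype.card α) / Real.log b := by
  have := μ.nonempty_of_neZero
  have : Nonempty α := this.map A
  have hsum := sum_measureReal_preimage_singleton_eq_one (μ := μ) hA
  have gibbs := sum_mul_log_le_sum_mul_log (s := Finset.univ)
    (p := fun a => μ.real (A ⁻¹' {a})) (q := fun _ => (Fintype.card α : ℝ)⁻¹)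
    (fun _ _ => measureReal_nonneg) (fun _ _ => by positivity) (fun _ _ _ => by positivity)
    (by simp [hsum])
  rw [← Finset.sum_mul, hsum, one_mul, Real.log_inv] at gibbs
  rw [entropy_comp_eq_sum hA fun a => a]
  refine div_le_div_of_nonneg_right ?_ (Real.log_nonneg hb)
  simp only [mul_neg, Finset.sum_neg_distrib]
  linarith

/-- The density that makes `A` and `B` conditionally independent given `f ∘ A = g ∘ B`. -/
lemma sum_condIndep_le_one {A : Ω → α} {B : Ω → β} (hA : Measurable A) (hB : Measurable B)
    {f : α → γ} {g : β → γ} (hfg : ∀ ω, f (A ω) = g (B ω)) [DecidableEq γ] :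
    ∑ x : α × β, (if f x.1 = g x.2 then
      μ.real (A ⁻¹' {x.1}) * μ.real (B ⁻¹' {x.2}) / μ.real ((fun ω => f (A ω)) ⁻¹' {f x.1})
      else 0) ≤ 1 := by
  rw [Fintype.sum_prod_type, ← sum_measureReal_preimage_singleton_eq_one (μ := μ) hA]
  refine Finset.sum_le_sum fun a _ => ?_
  have hfiber : ∑ b with f a = g b, μ.real (B ⁻¹' {b}) =
      μ.real ((fun ω => f (A ω)) ⁻¹' {f a}) := by
    rw [sum_measureReal_preimage_singleton _ fun b _ => hB (measurableSet_singleton b)]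
    congr 1
    ext ω
    simp [hfg, eq_comm]
  dsimp only
  rw [← Finset.sum_filter, ← Finset.sum_div, ← Finset.mul_sum, hfiber, mul_div_assoc]
  exact mul_le_of_le_one_right measureReal_nonneg (div_self_le_one _)

lemma entropy_submodular (hb : 1 ≤ b) {A : Ω → α} {B : Ω → β} [Fintype γ] (hA : Measurable A)
    (hB : Measurable B) (f : α → γ) (g : β → γ) (hfg : ∀ ω, f (A ω) = g (B ω)) :
    entropy b μ (fun ω => (A ω, B ω)) + entropy b μ (fun ω => f (A ω)) ≤
      entropy b μ A + entropy b μ B := by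
  classical
  set J : Ω → α × β := fun ω => (A ω, B ω)
  have hJ : Measurable J := hA.prodMk hB
  set p : α × β → ℝ := fun x => μ.real (J ⁻¹' {x})
  set pA : α → ℝ := fun a => μ.real (A ⁻¹' {a})
  set pB : β → ℝ := fun y => μ.real (B ⁻¹' {y})
  set pC : γ → ℝ := fun c => μ.real ((fun ω => f (A ω)) ⁻¹' {c})
  set q : α × β → ℝ :=
    fun x => if f x.1 = g x.2 then pA x.1 * pB x.2 / pC (f x.1) else 0
  have support : ∀ x, p x ≠ 0 → pA x.1 ≠ 0 ∧ pB x.2 ≠ 0 ∧ pC (f x.1) ≠ 0 ∧ f x.1 = g x.2 :=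
    fun x => marginals_ne_zero_of_measureReal_ne_zero hfg
  have gibbs : ∑ x, p x * Real.log (q x) ≤ ∑ x, p x * Real.log (p x) := by
    refine sum_mul_log_le_sum_mul_log (fun _ _ => measureReal_nonneg)
      (fun x _ => by dsimp only [q]; split_ifs <;> positivity) (fun x _ hx => ?_) ?_
    · obtain ⟨hxA, hxB, hxC, hx⟩ := support x hx
      simp [q, hx, hxA, hxB, hx ▸ hxC]
    · rw [sum_measureReal_preimage_singleton_eq_one hJ]
      exact sum_condIndep_le_one hA hB hfg
  have log_q : ∀ x, p x * Real.log (q x) =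
      p x * Real.log (pA x.1) + p x * Real.log (pB x.2) - p x * Real.log (pC (f x.1)) := by
    intro x
    by_cases hpx : p x = 0
    · simp [hpx]
    obtain ⟨hxA, hxB, hxC, hx⟩ := support x hpx
    simp only [q, if_pos hx]
    rw [Real.log_div (mul_ne_zero hxA hxB) hxC, Real.log_mul hxA hxB]
    ring
  rw [entropy_comp_eq_sum hJ fun x => x, entropy_comp_eq_sum hJ fun x => f x.1,
    entropy_comp_eq_sum hJ Prod.fst, entropy_comp_eq_sum hJ Prod.snd, ← add_div, ← add_div]
  refine div_le_div_of_nonneg_right ?_ (Real.log_nonneg hb)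
  change ∑ x, p x * -Real.log (p x) + ∑ x, p x * -Real.log (pC (f x.1)) ≤
    ∑ x, p x * -Real.log (pA x.1) + ∑ x, p x * -Real.log (pB x.2)
  simp only [log_q, Finset.sum_sub_distrib, Finset.sum_add_distrib] at gibbs
  simp only [mul_neg, Finset.sum_neg_distrib]
  linarith

end EntropyInequalities

section Subtuple

variable {Ω ι : Type*} {κ : ι → Type*}

/-- The part of the family `A` of random variables indexed by `s`, as a single variable. -/
def subtuple (A : ∀ i, Ω → κ i) (s : Finset ι) (ω : Ω) : ∀ i : s, κ i :=
  s.restrict fun i => A i ω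

lemma subtuple_eq_iff {A : ∀ i, Ω → κ i} {s : Finset ι} {ω ω' : Ω} :
    subtuple A s ω = subtuple A s ω' ↔ ∀ i ∈ s, A i ω = A i ω' := by
  simp [subtuple, funext_iff]

@[fun_prop]
lemma measurable_subtuple [MeasurableSpace Ω] [∀ i, MeasurableSpace (κ i)]
    {A : ∀ i, Ω → κ i} (hA : ∀ i, Measurable (A i)) (s : Finset ι) : Measurable (subtuple A s) :=
  (Finset.measurable_restrict s).comp (measurable_pi_lambda _ hA)

end Subtuple

section FunctionalDependence

variable {Ω α β γ δ ε : Type*} [MeasurableSpace Ω] {μ : Measure Ω} [IsProbabilityMeasure μ] {b : ℝ}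
  [Fintype α] [MeasurableSpace α] [MeasurableSingletonClass α]
  [Fintype β] [MeasurableSpace β] [MeasurableSingletonClass β]
  [Fintype δ] [Fintype ε]

lemma entropy_mono (hb : 1 ≤ b) {D : Ω → δ} {A : Ω → α} (hA : Measurable A)
    (h : D.FactorsThrough A) : entropy b μ D ≤ entropy b μ A := by
  have : Nonempty δ := μ.nonempty_of_neZero.map D
  obtain ⟨f, rfl⟩ := (Function.factorsThrough_iff D).1 h
  exact entropy_comp_le hb hA f

lemma entropy_congr (hb : 1 ≤ b) {A : Ω → α} {B : Ω → β} (hA : Measurable A) (hB : Measurable B)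
    (hAB : A.FactorsThrough B) (hBA : B.FactorsThrough A) : entropy b μ A = entropy b μ B :=
  (entropy_mono hb hB hAB).antisymm (entropy_mono hb hA hBA)

/-- Submodularity: `J` plays the role of the join of `A` and `B`, and `M` that of their meet. -/
lemma entropy_join_add_entropy_meet_le (hb : 1 ≤ b) {A : Ω → α} {B : Ω → β} {J : Ω → δ} {M : Ω → ε}
    (hA : Measurable A) (hB : Measurable B) (hJ : J.FactorsThrough fun ω => (A ω, B ω))
    (hMA : M.FactorsThrough A) (hMB : M.FactorsThrough B) :
    entropy b μ J + entropy b μ M ≤ entropy b μ A + entropy b μ B := by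
  have : Nonempty ε := μ.nonempty_of_neZero.map M
  obtain ⟨f, hf⟩ := (Function.factorsThrough_iff M).1 hMA
  obtain ⟨g, hg⟩ := (Function.factorsThrough_iff M).1 hMB
  have hsub := entropy_submodular (μ := μ) hb hA hB f g (congrFun (hf.symm.trans hg))
  have hmono := entropy_mono (μ := μ) hb (hA.prodMk hB) hJ
  rw [show (fun ω => f (A ω)) = M from hf.symm] at hsub
  linarith

lemma entropy_prodMk_le (hb : 1 ≤ b) {A : Ω → α} {B : Ω → β} (hA : Measurable A)
    (hB : Measurable B) : entropy b μ (fun ω => (A ω, B ω)) ≤ entropy b μ A + entropy b μ B := by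
  have hsub := entropy_submodular (μ := μ) hb hA hB (fun _ => ()) (fun _ => ()) fun _ => rfl
  rwa [entropy_const, add_zero] at hsub

lemma entropy_subtuple_le {ι : Type*} [DecidableEq ι] {κ : ι → Type*} [∀ i, Fintype (κ i)]
    [∀ i, MeasurableSpace (κ i)] [∀ i, MeasurableSingletonClass (κ i)] {A : ∀ i, Ω → κ i}
    (hb : 1 ≤ b) (hA : ∀ i, Measurable (A i)) (s : Finset ι) :
    entropy b μ (subtuple A s) ≤ ∑ i ∈ s, entropy b μ (A i) := by
  induction s using Finset.induction_on with
  | empty =>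
    rw [Finset.sum_empty, ← entropy_const (b := b) (μ := μ) ()]
    exact entropy_mono hb measurable_const fun ω ω' _ => by simp [subtuple_eq_iff]
  | insert i s hi ih =>
    rw [Finset.sum_insert hi]
    calc entropy b μ (subtuple A (insert i s))
        ≤ entropy b μ (fun ω => (A i ω, subtuple A s ω)) :=
          entropy_mono hb (by fun_prop) fun ω ω' h => by simpa [subtuple_eq_iff] using h
      _ ≤ entropy b μ (A i) + entropy b μ (subtuple A s) :=
          entropy_prodMk_le hb (hA i) (by fun_prop)
      _ ≤ _ := by gcongr

end FunctionalDependence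

section Determined

variable {Ω α β γ δ : Type*} [MeasurableSpace Ω] {μ : Measure Ω} {b : ℝ}
  [Fintype α] [Fintype β] [Fintype γ] [Fintype δ]

/-- `A` is almost surely a function of `B`, expressed by entropies: `H(A, B) ≤ H(B)`. -/
def Determined (b : ℝ) (μ : Measure Ω) (A : Ω → α) (B : Ω → β) : Prop :=
  entropy b μ (fun ω => (A ω, B ω)) ≤ entropy b μ B

lemma determined_of_condEntropy_eq_zero {A : Ω → α} {B : Ω → β}
    (h : condEntropy b μ A B = 0) : Determined b μ A B :=
  (sub_eq_zero.1 h).le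

variable [IsProbabilityMeasure μ]
  [MeasurableSpace α] [MeasurableSingletonClass α] [MeasurableSpace β] [MeasurableSingletonClass β]
  [MeasurableSpace γ] [MeasurableSingletonClass γ]

lemma determined_of_factorsThrough (hb : 1 ≤ b) {D : Ω → δ} {A : Ω → α} (hA : Measurable A)
    (h : D.FactorsThrough A) : Determined b μ D A :=
  entropy_mono hb hA fun _ _ e => Prod.ext (h e) e

lemma Determined.trans (hb : 1 ≤ b) {A : Ω → α} {B : Ω → β} {C : Ω → γ}
    (hA : Measurable A) (hB : Measurable B) (hC : Measurable C)
    (hAB : Determined b μ A B) (hBC : Determined b μ B C) : Determined b μ A C := by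
  have hsub := entropy_join_add_entropy_meet_le (μ := μ) hb (hA.prodMk hB) (hB.prodMk hC)
    (J := fun ω => (A ω, C ω)) (M := B) (fun ω ω' h => by simp_all) (fun ω ω' h => by simp_all)
    (fun ω ω' h => by simp_all)
  unfold Determined at *
  linarith

lemma Determined.prodMk (hb : 1 ≤ b) {A : Ω → α} {B : Ω → β} {C : Ω → γ}
    (hA : Measurable A) (hB : Measurable B) (hC : Measurable C)
    (hAC : Determined b μ A C) (hBC : Determined b μ B C) :
    Determined b μ (fun ω => (A ω, B ω)) C := by
  have hsub := entropy_join_add_entropy_meet_le (μ := μ) hb (hA.prodMk hC) (hB.prodMk hC)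
    (J := fun ω => ((A ω, B ω), C ω)) (M := C) (fun ω ω' h => by simp_all)
    (fun ω ω' h => by simp_all) (fun ω ω' h => by simp_all)
  unfold Determined at *
  linarith

lemma Determined.subtuple {ι : Type*} [DecidableEq ι] {κ : ι → Type*} [∀ i, Fintype (κ i)]
    [∀ i, MeasurableSpace (κ i)] [∀ i, MeasurableSingletonClass (κ i)] {A : ∀ i, Ω → κ i}
    (hb : 1 ≤ b) (hA : ∀ i, Measurable (A i)) {C : Ω → γ} (hC : Measurable C) (s : Finset ι)
    (h : ∀ i ∈ s, Determined b μ (A i) C) : Determined b μ (subtuple A s) C := by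
  induction s using Finset.induction_on with
  | empty => exact determined_of_factorsThrough hb hC fun ω ω' _ => by simp [subtuple_eq_iff]
  | insert i s _ ih =>
    have hpair : Determined b μ (fun ω => (A i ω, SecureAggregation.subtuple A s ω)) C :=
      .prodMk hb (hA i) (by fun_prop) hC (h i (Finset.mem_insert_self i s))
        (ih fun j hj => h j (Finset.mem_insert_of_mem hj))
    refine .trans hb (by fun_prop) (by fun_prop) hC
      (determined_of_factorsThrough hb (by fun_prop) fun ω ω' e => ?_) hpair
    simpa [subtuple_eq_iff] using e

end Determined

section EntropyIndep

variable {Ω α β γ δ : Type*} [MeasurableSpace Ω] {μ : Measure Ω} {b : ℝ}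
  [Fintype α] [Fintype β] [Fintype γ] [Fintype δ]

/-- `A` and `B` are independent, expressed by entropies: `H(A) + H(B) ≤ H(A, B)`. -/
def EntropyIndep (b : ℝ) (μ : Measure Ω) (A : Ω → α) (B : Ω → β) : Prop :=
  entropy b μ A + entropy b μ B ≤ entropy b μ (fun ω => (A ω, B ω))

variable [IsProbabilityMeasure μ]
  [MeasurableSpace α] [MeasurableSingletonClass α] [MeasurableSpace β] [MeasurableSingletonClass β]
  [MeasurableSpace γ] [MeasurableSingletonClass γ]

lemma EntropyIndep.symm (hb : 1 ≤ b) {A : Ω → α} {B : Ω → β} (hA : Measurable A)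
    (hB : Measurable B) (h : EntropyIndep b μ A B) : EntropyIndep b μ B A := by
  have hswap : entropy b μ (fun ω => (A ω, B ω)) ≤ entropy b μ fun ω => (B ω, A ω) :=
    entropy_mono hb (by fun_prop) fun ω ω' e => by simp_all
  unfold EntropyIndep at *
  linarith

lemma EntropyIndep.of_determined_left (hb : 1 ≤ b) {A : Ω → α} {B : Ω → β} {C : Ω → γ}
    (hA : Measurable A) (hB : Measurable B) (hC : Measurable C)
    (h : EntropyIndep b μ A B) (hCA : Determined b μ C A) : EntropyIndep b μ C B := by
  have hsub := entropy_join_add_entropy_meet_le (μ := μ) hb (hC.prodMk hA) (hC.prodMk hB)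
    (J := fun ω => (A ω, B ω)) (M := C) (fun ω ω' e => by simp_all) (fun ω ω' e => by simp_all)
    (fun ω ω' e => by simp_all)
  unfold EntropyIndep Determined at *
  linarith

lemma EntropyIndep.of_determined_right (hb : 1 ≤ b) {A : Ω → α} {B : Ω → β} {C : Ω → γ}
    (hA : Measurable A) (hB : Measurable B) (hC : Measurable C)
    (h : EntropyIndep b μ A B) (hCB : Determined b μ C B) : EntropyIndep b μ A C :=
  ((h.symm hb hA hB).of_determined_left hb hB hA hC hCB).symm hb hC hA

/-- A component `C` independent of all the rest is of no use in determining `A`. -/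
lemma Determined.of_entropyIndep (hb : 1 ≤ b) {A : Ω → α} {B : Ω → β} {C : Ω → γ}
    (hA : Measurable A) (hB : Measurable B) (hC : Measurable C)
    (hABC : Determined b μ A fun ω => (B ω, C ω))
    (hindep : EntropyIndep b μ (fun ω => (A ω, B ω)) C) : Determined b μ A B := by
  have hassoc : entropy b μ (fun ω => ((A ω, B ω), C ω)) ≤ entropy b μ fun ω => (A ω, B ω, C ω) :=
    entropy_mono hb (by fun_prop) fun ω ω' e => by simp_all
  have hBC := entropy_prodMk_le (μ := μ) hb hB hC
  unfold EntropyIndep Determined at *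
  linarith

section OneTimePad

variable {G : Type*} [AddGroup G] [Fintype G] [MeasurableSpace G] [MeasurableSingletonClass G]
  {A : Ω → α} {R N : Ω → G}

lemma entropy_prodMk_le_entropy_prodMk_add (hb : 1 ≤ b) (hA : Measurable A) (hR : Measurable R)
    (hN : Measurable N) (hRA : R.FactorsThrough A) :
    entropy b μ (fun ω => (A ω, N ω)) ≤ entropy b μ fun ω => (A ω, (R + N) ω) := by
  refine entropy_mono hb (hA.prodMk (hR.add hN)) fun ω ω' e => ?_
  obtain ⟨hAe, hsum⟩ := Prod.ext_iff.1 e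
  simp only [Pi.add_apply] at hsum
  rw [show R ω = R ω' from hRA hAe] at hsum
  exact Prod.ext hAe (add_left_cancel hsum)

lemma EntropyIndep.entropy_le_entropy_add (hb : 1 ≤ b) (hA : Measurable A) (hR : Measurable R)
    (hN : Measurable N) (hRA : R.FactorsThrough A) (h : EntropyIndep b μ A N) :
    entropy b μ N ≤ entropy b μ (R + N) := by
  have hrecover := entropy_prodMk_le_entropy_prodMk_add (μ := μ) hb hA hR hN hRA
  have hpair := entropy_prodMk_le (μ := μ) hb hA (hR.add hN)
  unfold EntropyIndep at h
  linarith

lemma EntropyIndep.add_uniform (hb : 1 ≤ b) (hA : Measurable A) (hR : Measurable R)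
    (hN : Measurable N) (hRA : R.FactorsThrough A)
    (huniform : entropy b μ N = Real.log (Fintype.card G) / Real.log b)
    (h : EntropyIndep b μ A N) : EntropyIndep b μ A (R + N) := by
  have hrecover := entropy_prodMk_le_entropy_prodMk_add (μ := μ) hb hA hR hN hRA
  have hcard := entropy_le_log_card (μ := μ) hb (hR.add hN)
  unfold EntropyIndep at *
  linarith

end OneTimePad

lemma EntropyIndep.of_condMutualInfo_eq_zero {σ τ : Type*} [Fintype σ] [MeasurableSpace σ]
    [MeasurableSingletonClass σ] [Fintype τ] [MeasurableSpace τ] [MeasurableSingletonClass τ]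
    (hb : 1 ≤ b) {A : Ω → α} {B : Ω → β} {C : Ω → γ} {P : Ω → σ} {Q : Ω → τ}
    (hA : Measurable A) (hB : Measurable B) (hC : Measurable C) (hP : Measurable P)
    (hQ : Measurable Q) (hAP : A.FactorsThrough P) (hBQ : B.FactorsThrough Q)
    (hPQ : condMutualInfo b μ P Q C = 0) (hAC : EntropyIndep b μ A C) : EntropyIndep b μ A B := by
  have reduce_Q := entropy_join_add_entropy_meet_le (μ := μ) hb
    (A := fun ω => (P ω, B ω, C ω)) (B := fun ω => (Q ω, C ω))
    (J := fun ω => (P ω, Q ω, C ω)) (M := fun ω => (B ω, C ω)) (by fun_prop) (by fun_prop)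
    (fun ω ω' e => by simp_all) (fun ω ω' e => by simp_all)
    (fun ω ω' e => by
      simp only [Prod.mk.injEq] at e
      exact Prod.ext (hBQ e.1) e.2)
  have reduce_P := entropy_join_add_entropy_meet_le (μ := μ) hb
    (A := fun ω => (A ω, B ω, C ω)) (B := fun ω => (P ω, C ω))
    (J := fun ω => (P ω, B ω, C ω)) (M := fun ω => (A ω, C ω)) (by fun_prop) (by fun_prop)
    (fun ω ω' e => by simp_all) (fun ω ω' e => by simp_all)
    (fun ω ω' e => by
      simp only [Prod.mk.injEq] at e
      exact Prod.ext (hAP e.1) e.2)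
  have discard_C := entropy_join_add_entropy_meet_le (μ := μ) hb
    (A := fun ω => (A ω, B ω)) (B := fun ω => (B ω, C ω))
    (J := fun ω => (A ω, B ω, C ω)) (M := B) (by fun_prop) (by fun_prop)
    (fun ω ω' e => by simp_all) (fun ω ω' e => by simp_all) (fun ω ω' e => by simp_all)
  unfold condMutualInfo condEntropy at hPQ
  unfold EntropyIndep at *
  linarith

end EntropyIndep

/-! ### Converse -/

section Shearer

lemma shearer_inequality {ι τ : Type*} [DecidableEq ι] (h : Finset ι → ℝ)
    (hsub : ∀ s t, h (s ∪ t) + h (s ∩ t) ≤ h s + h t) {J : Finset τ} {B : τ → Finset ι}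
    {E : Finset ι} {m : ℕ} (hB : ∀ u ∈ J, B u ⊆ E) (hm : ∀ i ∈ E, {u ∈ J | i ∈ B u}.card = m) :
    m * (h E - h ∅) ≤ ∑ u ∈ J, (h (B u) - h ∅) := by
  have restricted : ∀ s ⊆ E, m * (h s - h ∅) ≤ ∑ u ∈ J, (h (B u ∩ s) - h ∅) := by
    intro s
    induction s using Finset.induction_on with
    | empty => simp
    | insert i s hi ih =>
      intro hs
      have hstep : ∑ u ∈ J, (if i ∈ B u then h (insert i s) - h s else 0) ≤
          ∑ u ∈ J, (h (B u ∩ insert i s) - h (B u ∩ s)) := by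
        refine Finset.sum_le_sum fun u _ => ?_
        split_ifs with hu
        · have := hsub (B u ∩ insert i s) s
          rw [show (B u ∩ insert i s) ∪ s = insert i s by grind,
            show (B u ∩ insert i s) ∩ s = B u ∩ s by grind] at this
          linarith
        · rw [Finset.inter_insert_of_notMem hu, sub_self]
      rw [← Finset.sum_filter, Finset.sum_const, hm i (hs (Finset.mem_insert_self i s)),
        nsmul_eq_mul] at hstep
      have ih := ih ((Finset.subset_insert i s).trans hs)
      simp only [Finset.sum_sub_distrib] at hstep ih ⊢
      linarith
  have := restricted E subset_rfl
  rwa [Finset.sum_congr rfl fun u hu => by rw [Finset.inter_eq_left.2 (hB u hu)]] at this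

lemma entropy_prodMk_subtuple_submodular {Ω α ι : Type*} [MeasurableSpace Ω] {μ : Measure Ω}
    [IsProbabilityMeasure μ] {b : ℝ} [Fintype α] [MeasurableSpace α] [MeasurableSingletonClass α]
    [DecidableEq ι] {κ : ι → Type*} [∀ i, Fintype (κ i)] [∀ i, MeasurableSpace (κ i)]
    [∀ i, MeasurableSingletonClass (κ i)] (hb : 1 ≤ b) {T : Ω → α} {A : ∀ i, Ω → κ i}
    (hT : Measurable T) (hA : ∀ i, Measurable (A i)) (s t : Finset ι) :
    entropy b μ (fun ω => (T ω, subtuple A (s ∪ t) ω)) +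
        entropy b μ (fun ω => (T ω, subtuple A (s ∩ t) ω)) ≤
      entropy b μ (fun ω => (T ω, subtuple A s ω)) +
        entropy b μ (fun ω => (T ω, subtuple A t ω)) := by
  refine entropy_join_add_entropy_meet_le hb (by fun_prop) (by fun_prop) ?_ ?_ ?_ <;>
  · intro ω ω' e
    simp only [Prod.mk.injEq, subtuple_eq_iff] at e ⊢
    grind

end Shearer

lemma choose_mul_choose_sub_comm (n a b : ℕ) :
    n.choose a * (n - a).choose b = n.choose b * (n - b).choose a := by
  have hab := Nat.choose_mul (n := n) (Nat.le_add_right a b)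
  have hba := Nat.choose_mul (n := n) (Nat.le_add_left b a)
  rw [Nat.add_sub_cancel_left] at hab
  rw [Nat.add_sub_cancel] at hba
  rw [← hab, ← hba, Nat.choose_symm_add]

namespace Scheme

variable {K S L : ℕ} {F : Type u} {𝒮 : Scheme K S L F}

section Converse

instance (V : UserGroup K S) : MeasurableSpace (𝒮.Key V) := ⊤

instance (V : UserGroup K S) : DiscreteMeasurableSpace (𝒮.Key V) := ⟨fun _ => trivial⟩

instance (k : Fin K) : MeasurableSpace (𝒮.Msg₁ k) := ⊤

instance (k : Fin K) : DiscreteMeasurableSpace (𝒮.Msg₁ k) := ⟨fun _ => trivial⟩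

instance (U₁ : Finset (Fin K)) (k : Fin K) : MeasurableSpace (𝒮.Msg₂ U₁ k) := ⊤

instance (U₁ : Finset (Fin K)) (k : Fin K) : DiscreteMeasurableSpace (𝒮.Msg₂ U₁ k) :=
  ⟨fun _ => trivial⟩

attribute [fun_prop] measurable_Z measurable_X measurable_Y

@[fun_prop]
lemma measurable_userKeys (k : Fin K) : Measurable (𝒮.userKeys k) :=
  measurable_pi_lambda _ fun V => 𝒮.measurable_Z V.1

/-- All messages seen by the server when the users of `U₁` survive the first round. -/
def transcript (𝒮 : Scheme K S L F) (U₁ : Finset (Fin K)) (ω : 𝒮.Ω) :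
    (∀ k, 𝒮.Msg₁ k) × (∀ k : U₁, 𝒮.Msg₂ U₁ k) :=
  ((fun k => 𝒮.X k ω), (fun k : U₁ => 𝒮.Y U₁ k ω))

@[fun_prop]
lemma measurable_transcript (U₁ : Finset (Fin K)) : Measurable (𝒮.transcript U₁) := by
  unfold transcript
  fun_prop

/-- The keys of a set of groups together with the inputs of a set of users. -/
def sources (𝒮 : Scheme K S L F) (P : Finset (UserGroup K S)) (Q : Finset (Fin K)) (ω : 𝒮.Ω) :
    (∀ V : P, 𝒮.Key V) × (Q → Fin L → F) :=
  (subtuple 𝒮.Z P ω, subtuple 𝒮.W Q ω)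

lemma sources_eq_iff {P : Finset (UserGroup K S)} {Q : Finset (Fin K)} {ω ω' : 𝒮.Ω} :
    𝒮.sources P Q ω = 𝒮.sources P Q ω' ↔
      (∀ V ∈ P, 𝒮.Z V ω = 𝒮.Z V ω') ∧ ∀ k ∈ Q, 𝒮.W k ω = 𝒮.W k ω' := by
  simp only [sources, Prod.mk.injEq, subtuple_eq_iff]

/-- The groups containing user `k`. -/
def groupsOf (S : ℕ) (k : Fin K) : Finset (UserGroup K S) := {V | k ∈ V.1}

/-- The groups containing user `k` and some member of `U₂`: these index the keys that user `k`
shares with `U₂`. -/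
def groupsMeeting (S : ℕ) (k : Fin K) (U₂ : Finset (Fin K)) : Finset (UserGroup K S) :=
  {V | k ∈ V.1 ∧ ¬ Disjoint V.1 U₂}

/-- The groups containing some member of `U₂` but not user `k`. -/
def groupsAvoiding (S : ℕ) (k : Fin K) (U₂ : Finset (Fin K)) : Finset (UserGroup K S) :=
  {V | k ∉ V.1 ∧ ¬ Disjoint V.1 U₂}

lemma groupsMeeting_subset_groupsOf (k : Fin K) (U₂ : Finset (Fin K)) :
    groupsMeeting S k U₂ ⊆ groupsOf S k :=
  Finset.monotone_filter_right _ fun _ _ hV => hV.1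

lemma card_filter_mem_groupsMeeting {k : Fin K} {V : UserGroup K S} (hk : k ∈ V.1) (U : ℕ) :
    {U₂ ∈ (Finset.univ.erase k).powersetCard U | V ∈ groupsMeeting S k U₂}.card =
      (K - 1).choose U - (K - S).choose U := by
  have hsub : V.1ᶜ.powersetCard U ⊆ (Finset.univ.erase k).powersetCard U :=
    Finset.powersetCard_mono fun x hx => by
      rw [Finset.mem_erase]
      exact ⟨fun e => Finset.mem_compl.1 hx (e ▸ hk), Finset.mem_univ x⟩
  have hsdiff : {U₂ ∈ (Finset.univ.erase k).powersetCard U | V ∈ groupsMeeting S k U₂} =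
      (Finset.univ.erase k).powersetCard U \ V.1ᶜ.powersetCard U := by
    ext U₂
    simp only [groupsMeeting, Finset.mem_filter, Finset.mem_univ, true_and, hk, Finset.mem_sdiff,
      Finset.mem_powersetCard, ← le_compl_iff_disjoint_left]
    tauto
  rw [hsdiff, Finset.card_sdiff_of_subset hsub, Finset.card_powersetCard, Finset.card_powersetCard,
    Finset.card_erase_of_mem (Finset.mem_univ k), Finset.card_compl, Finset.card_univ,
    Fintype.card_fin, V.2]

lemma sum_sum_groupsMeeting (k : Fin K) (U : ℕ) (z : UserGroup K S → ℝ) :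
    ∑ U₂ ∈ (Finset.univ.erase k).powersetCard U, ∑ V ∈ groupsMeeting S k U₂, z V =
      ((K - 1).choose U - (K - S).choose U : ℕ) * ∑ V ∈ groupsOf S k, z V := by
  rw [Finset.sum_comm' (t' := groupsOf S k) (s' := fun V =>
    {U₂ ∈ (Finset.univ.erase k).powersetCard U | V ∈ groupsMeeting S k U₂}), Finset.mul_sum]
  · refine Finset.sum_congr rfl fun V hV => ?_
    rw [Finset.sum_const, card_filter_mem_groupsMeeting (by simpa [groupsOf] using hV),
      nsmul_eq_mul]
  · intro U₂ V
    have := @groupsMeeting_subset_groupsOf K S k U₂ V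
    rw [Finset.mem_filter]
    tauto

lemma userData_factorsThrough {k j : Fin K} {U₂ : Finset (Fin K)} (hj : j ∈ U₂) :
    (fun ω => (𝒮.W j ω, 𝒮.userKeys j ω)).FactorsThrough
      fun ω => (subtuple 𝒮.Z (groupsMeeting S k U₂) ω, 𝒮.sources (groupsAvoiding S k U₂) U₂ ω) := by
  intro ω ω' e
  simp only [Prod.mk.injEq, sources_eq_iff, subtuple_eq_iff, groupsMeeting, groupsAvoiding,
    Finset.mem_filter, Finset.mem_univ, true_and] at e
  obtain ⟨hmeeting, havoiding, hinputs⟩ := e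
  refine Prod.ext (hinputs j hj) (funext fun V => ?_)
  have hV : ¬ Disjoint V.1.1 U₂ := Finset.not_disjoint_iff.2 ⟨j, V.2, hj⟩
  by_cases hk : k ∈ V.1.1
  exacts [hmeeting V.1 ⟨hk, hV⟩, havoiding V.1 ⟨hk, hV⟩]

variable [Field F]

/-- The discrete σ-algebra on the alphabet of the inputs. -/
local instance fieldMeasurableSpace {F : Type*} [Field F] : MeasurableSpace F := ⊤

local instance {F : Type*} [Field F] : DiscreteMeasurableSpace F := ⟨fun _ => trivial⟩

@[fun_prop]
lemma measurable_input (k : Fin K) : Measurable (𝒮.W k) :=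
  (𝒮.measurable_W k).mono le_rfl le_top

@[fun_prop]
lemma measurable_sumInputs [Finite F] (U₁ : Finset (Fin K)) : Measurable (𝒮.sumInputs U₁) :=
  (measurable_of_finite fun w : Fin K → Fin L → F => ∑ k ∈ U₁, w k).comp
    (measurable_pi_lambda _ measurable_input)

@[fun_prop]
lemma measurable_sources (P : Finset (UserGroup K S)) (Q : Finset (Fin K)) :
    Measurable (𝒮.sources P Q) := by
  unfold sources
  fun_prop

lemma sumInputs_eq_add {U₁ : Finset (Fin K)} {j : Fin K} (hj : j ∈ U₁) :
    𝒮.sumInputs U₁ = 𝒮.sumInputs (U₁.erase j) + 𝒮.W j :=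
  funext fun _ => (Finset.sum_erase_add _ _ hj).symm

lemma sumInputs_factorsThrough {U₁ Q : Finset (Fin K)} (hQ : U₁ ⊆ Q) :
    (𝒮.sumInputs U₁).FactorsThrough (subtuple 𝒮.W Q) :=
  fun _ _ e => Finset.sum_congr rfl fun k hk => subtuple_eq_iff.1 e k (hQ hk)

variable [Fintype F] {U : ℕ}

lemma one_le_card : (1 : ℝ) ≤ Fintype.card F := by exact_mod_cast Fintype.one_lt_card.le

lemma log_card_vector_div_log_card :
    Real.log (Fintype.card (Fin L → F)) / Real.log (Fintype.card F) = L := by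
  have : Real.log (Fintype.card F) ≠ 0 :=
    (Real.log_pos (by exact_mod_cast Fintype.one_lt_card)).ne'
  rw [Fintype.card_fun, Fintype.card_fin, Nat.cast_pow, Real.log_pow, mul_div_cancel_right₀ _ this]

lemma H_input (h : 𝒮.IsSecureAggregation U) (k : Fin K) : 𝒮.H (𝒮.W k) = L := by
  rw [← log_card_vector_div_log_card (F := F)]
  simp only [H, entropy, h.uniform k, Finset.sum_const, Finset.card_univ, Fintype.card_fun,
    Fintype.card_fin, nsmul_eq_mul, Real.negMulLog, one_div, Real.log_inv]
  push_cast
  field_simp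

lemma H_sources_le (h : 𝒮.IsSecureAggregation U) (P : Finset (UserGroup K S))
    (Q : Finset (Fin K)) : 𝒮.H (𝒮.sources P Q) ≤ ∑ V ∈ P, 𝒮.H (𝒮.Z V) + Q.card * L := by
  have hinputs : ∑ k ∈ Q, 𝒮.H (𝒮.W k) = Q.card * L := by simp [H_input h]
  rw [← hinputs]
  exact (entropy_prodMk_le one_le_card (by fun_prop) (by fun_prop)).trans (add_le_add
    (entropy_subtuple_le one_le_card 𝒮.measurable_Z P)
    (entropy_subtuple_le one_le_card measurable_input Q))

lemma H_sources (h : 𝒮.IsSecureAggregation U) (P : Finset (UserGroup K S))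
    (Q : Finset (Fin K)) : 𝒮.H (𝒮.sources P Q) = ∑ V ∈ P, 𝒮.H (𝒮.Z V) + Q.card * L := by
  have hcompl := H_sources_le h Pᶜ Qᶜ
  have hpair := entropy_prodMk_le (μ := 𝒮.μ) (one_le_card (F := F))
    (A := 𝒮.sources P Q) (B := 𝒮.sources Pᶜ Qᶜ) (by fun_prop) (by fun_prop)
  have hall : 𝒮.H (fun ω => ((fun V => 𝒮.Z V ω), (fun k => 𝒮.W k ω))) ≤
      𝒮.H (fun ω => (𝒮.sources P Q ω, 𝒮.sources Pᶜ Qᶜ ω)) := by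
    refine entropy_mono one_le_card (by fun_prop) fun ω ω' e => ?_
    simp only [Prod.mk.injEq, sources_eq_iff, Finset.mem_compl, funext_iff (β := 𝒮.Key),
      funext_iff (α := Fin K)] at e ⊢
    grind
  have hQ : (Q.card : ℝ) + Qᶜ.card = K := by
    exact_mod_cast (Finset.card_add_card_compl Q).trans (Fintype.card_fin K)
  have hP := Finset.sum_add_sum_compl P fun V => 𝒮.H (𝒮.Z V)
  rw [h.keys, Finset.sum_congr rfl fun k _ => H_input h k, Finset.sum_const, Finset.card_univ,
    Fintype.card_fin, nsmul_eq_mul, ← hQ] at hall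
  refine (H_sources_le h P Q).antisymm ?_
  unfold H at *
  linarith

lemma entropyIndep_sources (h : 𝒮.IsSecureAggregation U) {P P' : Finset (UserGroup K S)}
    {Q Q' : Finset (Fin K)} (hP : Disjoint P P') (hQ : Disjoint Q Q') :
    EntropyIndep (Fintype.card F) 𝒮.μ (𝒮.sources P Q) (𝒮.sources P' Q') := by
  have hunion : 𝒮.H (𝒮.sources (P ∪ P') (Q ∪ Q')) ≤
      𝒮.H (fun ω => (𝒮.sources P Q ω, 𝒮.sources P' Q' ω)) := by
    refine entropy_mono one_le_card (by fun_prop) fun ω ω' e => ?_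
    simp only [Prod.mk.injEq, sources_eq_iff] at e ⊢
    grind
  refine le_trans (le_of_eq ?_) hunion
  change 𝒮.H _ + 𝒮.H _ = _
  rw [H_sources h, H_sources h, H_sources h, Finset.sum_union hP, Finset.card_union_of_disjoint hQ]
  push_cast
  ring

lemma entropyIndep_inputs_compl (h : 𝒮.IsSecureAggregation U) (j : Fin K) :
    EntropyIndep (Fintype.card F) 𝒮.μ (subtuple 𝒮.W {j}ᶜ) (𝒮.W j) := by
  have hb := one_le_card (F := F)
  have hsources : EntropyIndep (Fintype.card F) 𝒮.μ (𝒮.sources ∅ {j}ᶜ) (𝒮.sources ∅ {j}) :=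
    entropyIndep_sources h (Finset.disjoint_empty_left _) disjoint_compl_left
  refine (hsources.of_determined_left hb (by fun_prop) (by fun_prop) (by fun_prop)
    (determined_of_factorsThrough (D := subtuple 𝒮.W {j}ᶜ) hb (by fun_prop)
      fun ω ω' e => ?_)).of_determined_right hb
    (by fun_prop) (by fun_prop) (by fun_prop)
    (determined_of_factorsThrough hb (by fun_prop) fun ω ω' e => ?_) <;>
  simp_all [sources_eq_iff, subtuple_eq_iff]

lemma le_H_sumInputs (h : 𝒮.IsSecureAggregation U) {U₁ : Finset (Fin K)} {j : Fin K}
    (hj : j ∈ U₁) : L ≤ 𝒮.H (𝒮.sumInputs U₁) := by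
  rw [← H_input h j, sumInputs_eq_add hj]
  exact (entropyIndep_inputs_compl h j).entropy_le_entropy_add one_le_card (by fun_prop)
    (by fun_prop) (by fun_prop) (sumInputs_factorsThrough fun k => by simp +contextual)

lemma entropyIndep_sumInputs (h : 𝒮.IsSecureAggregation U) {α : Type*} [Fintype α]
    [MeasurableSpace α] [MeasurableSingletonClass α] {A : 𝒮.Ω → α} (hA : Measurable A)
    {U₁ : Finset (Fin K)} {j : Fin K} (hj : j ∈ U₁) (hAj : A.FactorsThrough (subtuple 𝒮.W {j}ᶜ)) :
    EntropyIndep (Fintype.card F) 𝒮.μ A (𝒮.sumInputs U₁) := by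
  have hb := one_le_card (F := F)
  have hpad := (entropyIndep_inputs_compl h j).add_uniform hb (R := 𝒮.sumInputs (U₁.erase j))
    (by fun_prop) (by fun_prop) (by fun_prop)
    (sumInputs_factorsThrough fun k => by simp +contextual)
    ((H_input h j).trans log_card_vector_div_log_card.symm)
  rw [← sumInputs_eq_add hj] at hpad
  exact hpad.of_determined_left hb (by fun_prop) (by fun_prop) hA
    (determined_of_factorsThrough hb (by fun_prop) hAj)

/-- The inputs other than `W j` are hidden, since the only information leaked about the inputs is
a sum in which `W j` acts as a one-time pad. -/
lemma entropyIndep_transcript (h : 𝒮.IsSecureAggregation U) {α β : Type*} [Fintype α]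
    [MeasurableSpace α] [MeasurableSingletonClass α] [Fintype β] [MeasurableSpace β]
    [MeasurableSingletonClass β] {A : 𝒮.Ω → α} {B : 𝒮.Ω → β} (hA : Measurable A)
    (hB : Measurable B) {U₁ : Finset (Fin K)} (hU₁ : U ≤ U₁.card) {j : Fin K} (hj : j ∈ U₁)
    (hAj : A.FactorsThrough (subtuple 𝒮.W {j}ᶜ)) (hBU₁ : B.FactorsThrough (𝒮.transcript U₁)) :
    EntropyIndep (Fintype.card F) 𝒮.μ A B :=
  .of_condMutualInfo_eq_zero one_le_card hA hB (C := 𝒮.sumInputs U₁) (P := fun ω k => 𝒮.W k ω)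
    (by fun_prop) (by fun_prop) (measurable_transcript U₁)
    (fun ω ω' e => hAj (subtuple_eq_iff.2 fun k _ => congrFun e k)) hBU₁ (h.secure U₁ hU₁)
    (entropyIndep_sumInputs h hA hj hAj)

theorem le_sum_H_msg₂ (h : 𝒮.IsSecureAggregation U) (hU : 1 ≤ U) {U₁ : Finset (Fin K)}
    (hU₁ : U₁.card = U) (hUK : U < K) : (L : ℝ) ≤ ∑ k ∈ U₁, 𝒮.H (𝒮.Y U₁ k) := by
  have hb := one_le_card (F := F)
  obtain ⟨j, hj⟩ : ∃ j, j ∉ U₁ := by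
    by_contra! hall
    simp [Finset.eq_univ_iff_forall.2 hall] at hU₁
    omega
  obtain ⟨i, hi⟩ : U₁.Nonempty := Finset.card_pos.1 (by omega)
  let X (ω : 𝒮.Ω) (k : Fin K) : 𝒮.Msg₁ k := 𝒮.X k ω
  have hX : Measurable X := by fun_prop
  have huniform := le_H_sumInputs h hi
  have hhidden : EntropyIndep (Fintype.card F) 𝒮.μ (𝒮.sumInputs U₁) X :=
    entropyIndep_transcript h (by fun_prop) hX (U₁ := insert j U₁)
      (by rw [Finset.card_insert_of_notMem hj]; omega) (Finset.mem_insert_self j U₁)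
      (sumInputs_factorsThrough (by simpa using hj))
      fun ω ω' e => (Prod.ext_iff.1 e).1
  have hdecode : Determined (Fintype.card F) 𝒮.μ (𝒮.sumInputs U₁)
      (fun ω => (X ω, subtuple (𝒮.Y U₁) U₁ ω)) :=
    .trans hb (B := fun ω => (subtuple 𝒮.X U₁ ω, subtuple (𝒮.Y U₁) U₁ ω)) (by fun_prop)
      (by fun_prop) (by fun_prop)
      (determined_of_condEntropy_eq_zero (h.decode U₁ U₁ subset_rfl hU₁.ge))
      (determined_of_factorsThrough hb (by fun_prop) fun ω ω' e => by
        simp only [Prod.mk.injEq, X, funext_iff] at e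
        exact Prod.ext (subtuple_eq_iff.2 fun k _ => e.1 k) (funext e.2))
  have hforget := entropy_mono (μ := 𝒮.μ) hb (D := fun ω => (𝒮.sumInputs U₁ ω, X ω))
    (A := fun ω => (𝒮.sumInputs U₁ ω, X ω, subtuple (𝒮.Y U₁) U₁ ω)) (by fun_prop)
    (fun ω ω' e => by simp_all)
  have hpair := entropy_prodMk_le (μ := 𝒮.μ) hb hX (B := subtuple (𝒮.Y U₁) U₁) (by fun_prop)
  have hY := entropy_subtuple_le (μ := 𝒮.μ) hb (𝒮.measurable_Y U₁) U₁
  unfold Determined EntropyIndep at *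
  unfold H at *
  linarith

section OutsideData

variable {k : Fin K} {U₂ : Finset (Fin K)}

lemma determined_sumInputs_insert (h : 𝒮.IsSecureAggregation U) (hU₂ : U ≤ U₂.card) :
    Determined (Fintype.card F) 𝒮.μ (𝒮.sumInputs (insert k U₂)) fun ω =>
      (𝒮.X k ω, subtuple 𝒮.Z (groupsMeeting S k U₂) ω, 𝒮.sources (groupsAvoiding S k U₂) U₂ ω) := by
  have hb := one_le_card (F := F)
  set C := fun ω =>
    (𝒮.X k ω, subtuple 𝒮.Z (groupsMeeting S k U₂) ω, 𝒮.sources (groupsAvoiding S k U₂) U₂ ω) with hC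
  have hCmeas : Measurable C := by fun_prop
  have hsub : U₂ ⊆ insert k U₂ := Finset.subset_insert _ _
  have hcard : U ≤ (insert k U₂).card := hU₂.trans (Finset.card_le_card hsub)
  have hdata : ∀ j ∈ U₂, Determined (Fintype.card F) 𝒮.μ
      (fun ω => (𝒮.W j ω, 𝒮.userKeys j ω)) C := fun j hj =>
    determined_of_factorsThrough hb hCmeas fun ω ω' e =>
      userData_factorsThrough hj (Prod.ext_iff.1 e).2
  have hX : ∀ j ∈ insert k U₂, Determined (Fintype.card F) 𝒮.μ (𝒮.X j) C := by
    intro j hj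
    rcases Finset.mem_insert.1 hj with rfl | hj
    · exact determined_of_factorsThrough hb hCmeas fun ω ω' e => (Prod.ext_iff.1 e).1
    · exact (determined_of_condEntropy_eq_zero (h.encode₁ j)).trans hb (by fun_prop)
        (by fun_prop) hCmeas (hdata j hj)
  have hY : ∀ j ∈ U₂, Determined (Fintype.card F) 𝒮.μ (𝒮.Y (insert k U₂) j) C := fun j hj =>
    (determined_of_condEntropy_eq_zero (h.encode₂ _ hcard j (hsub hj))).trans hb (by fun_prop)
      (by fun_prop) hCmeas (hdata j hj)
  have hdecode : Determined (Fintype.card F) 𝒮.μ (𝒮.sumInputs (insert k U₂)) fun ω =>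
      (subtuple 𝒮.X (insert k U₂) ω, subtuple (𝒮.Y (insert k U₂)) U₂ ω) :=
    determined_of_condEntropy_eq_zero (h.decode (insert k U₂) U₂ hsub hU₂)
  exact hdecode.trans hb (by fun_prop) (by fun_prop) hCmeas
    (.prodMk hb (by fun_prop) (by fun_prop) hCmeas
      (.subtuple hb 𝒮.measurable_X hCmeas _ hX) (.subtuple hb (𝒮.measurable_Y _) hCmeas _ hY))

lemma determined_input_of_outside (h : 𝒮.IsSecureAggregation U) (hk : k ∉ U₂)
    (hU₂ : U ≤ U₂.card) :
    Determined (Fintype.card F) 𝒮.μ (𝒮.W k) fun ω =>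
      ((𝒮.X k ω, subtuple 𝒮.Z (groupsMeeting S k U₂) ω),
        𝒮.sources (groupsAvoiding S k U₂) U₂ ω) := by
  have hb := one_le_card (F := F)
  have hsum := (determined_sumInputs_insert (k := k) h hU₂).trans hb (by fun_prop) (by fun_prop)
    (C := fun ω => ((𝒮.X k ω, subtuple 𝒮.Z (groupsMeeting S k U₂) ω),
      𝒮.sources (groupsAvoiding S k U₂) U₂ ω)) (by fun_prop)
    (determined_of_factorsThrough hb (by fun_prop) fun ω ω' e => by simp_all)
  refine .trans hb (B := fun ω =>
    (𝒮.sumInputs (insert k U₂) ω, 𝒮.sources (groupsAvoiding S k U₂) U₂ ω))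
    (by fun_prop) (by fun_prop) (by fun_prop)
    (determined_of_factorsThrough hb (by fun_prop) fun ω ω' e => ?_)
    (.prodMk hb (by fun_prop) (by fun_prop) (by fun_prop) hsum
      (determined_of_factorsThrough hb (by fun_prop) fun ω ω' e => (Prod.ext_iff.1 e).2))
  simp only [Prod.mk.injEq, sources_eq_iff, sumInputs, Finset.sum_insert hk] at e
  rw [Finset.sum_congr rfl fun j hj => e.2.2 j hj] at e
  exact add_right_cancel e.1

lemma entropyIndep_outside (h : 𝒮.IsSecureAggregation U) (hk : k ∉ U₂) :
    EntropyIndep (Fintype.card F) 𝒮.μ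
      (fun ω => (𝒮.W k ω, 𝒮.X k ω, subtuple 𝒮.Z (groupsMeeting S k U₂) ω))
      (𝒮.sources (groupsAvoiding S k U₂) U₂) := by
  have hb := one_le_card (F := F)
  have hown : Measurable (𝒮.sources (groupsOf S k) {k}) := by fun_prop
  have hdisj : Disjoint (groupsOf S k) (groupsAvoiding S k U₂) :=
    Finset.disjoint_filter.2 fun V _ h₁ h₂ => h₂.1 h₁
  have hX : Determined (Fintype.card F) 𝒮.μ (𝒮.X k) (𝒮.sources (groupsOf S k) {k}) := by
    refine (determined_of_condEntropy_eq_zero (h.encode₁ k)).trans hb (by fun_prop) (by fun_prop)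
      hown (determined_of_factorsThrough hb hown fun ω ω' e => ?_)
    rw [sources_eq_iff] at e
    exact Prod.ext (e.2 k (by simp)) (funext fun V => e.1 V.1 (by simpa [groupsOf] using V.2))
  refine (entropyIndep_sources h hdisj (Finset.disjoint_singleton_left.2 hk)).of_determined_left
    hb hown (by fun_prop) (by fun_prop) (.prodMk hb (by fun_prop) (by fun_prop) hown ?_
      (.prodMk hb (by fun_prop) (by fun_prop) hown hX ?_)) <;>
  refine determined_of_factorsThrough hb hown fun ω ω' e => ?_ <;>
  rw [sources_eq_iff] at e
  · exact e.2 k (by simp)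
  · exact subtuple_eq_iff.2 fun V hV => e.1 V (by simp_all [groupsOf, groupsMeeting])

lemma determined_input (h : 𝒮.IsSecureAggregation U) (hk : k ∉ U₂) (hU₂ : U ≤ U₂.card) :
    Determined (Fintype.card F) 𝒮.μ (𝒮.W k) fun ω =>
      (𝒮.X k ω, subtuple 𝒮.Z (groupsMeeting S k U₂) ω) :=
  .of_entropyIndep one_le_card (by fun_prop) (by fun_prop) (by fun_prop)
    (determined_input_of_outside h hk hU₂) (entropyIndep_outside h hk)

end OutsideData

lemma H_input_msg₁ (h : 𝒮.IsSecureAggregation U) (hUK : U < K) (hK : 1 < K) (k : Fin K) :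
    𝒮.H (fun ω => (𝒮.W k ω, 𝒮.X k ω)) = L + 𝒮.H (𝒮.X k) := by
  have : Nontrivial (Fin K) := Fin.nontrivial_iff_two_le.2 hK
  obtain ⟨j, hj⟩ := exists_ne k
  have hupper := entropy_prodMk_le (μ := 𝒮.μ) (one_le_card (F := F)) (measurable_input k)
    (𝒮.measurable_X k)
  have hhidden : EntropyIndep (Fintype.card F) 𝒮.μ (𝒮.W k) (𝒮.X k) :=
    entropyIndep_transcript h (by fun_prop) (by fun_prop) (U₁ := Finset.univ)
      (by simpa using hUK.le) (Finset.mem_univ j)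
      (fun ω ω' e => subtuple_eq_iff.1 e k (by simpa using hj.symm))
      fun ω ω' e => congrFun (Prod.ext_iff.1 e).1 k
  rw [← H_input h k]
  exact hupper.antisymm hhidden

lemma H_input_msg₁_groupsMeeting_le (h : 𝒮.IsSecureAggregation U) {k : Fin K}
    {U₂ : Finset (Fin K)} (hk : k ∉ U₂) (hU₂ : U ≤ U₂.card) :
    𝒮.H (fun ω => ((𝒮.W k ω, 𝒮.X k ω), subtuple 𝒮.Z (groupsMeeting S k U₂) ω)) ≤
      𝒮.H (𝒮.X k) + ∑ V ∈ groupsMeeting S k U₂, 𝒮.H (𝒮.Z V) := by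
  have hb := one_le_card (F := F)
  have hassoc := entropy_mono (μ := 𝒮.μ) hb
    (D := fun ω => ((𝒮.W k ω, 𝒮.X k ω), subtuple 𝒮.Z (groupsMeeting S k U₂) ω))
    (A := fun ω => (𝒮.W k ω, 𝒮.X k ω, subtuple 𝒮.Z (groupsMeeting S k U₂) ω))
    (by fun_prop) fun ω ω' e => by simp_all
  have hdet := determined_input h hk hU₂
  have hpair := entropy_prodMk_le (μ := 𝒮.μ) hb (𝒮.measurable_X k)
    (B := subtuple 𝒮.Z (groupsMeeting S k U₂)) (by fun_prop)
  have hkeys := entropy_subtuple_le (μ := 𝒮.μ) hb 𝒮.measurable_Z (groupsMeeting S k U₂)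
  unfold Determined at hdet
  unfold H
  linarith

lemma le_H_input_msg₁_groupsOf (h : 𝒮.IsSecureAggregation U) (k : Fin K) :
    L + ∑ V ∈ groupsOf S k, 𝒮.H (𝒮.Z V) ≤
      𝒮.H (fun ω => ((𝒮.W k ω, 𝒮.X k ω), subtuple 𝒮.Z (groupsOf S k) ω)) := by
  have hsources := H_sources h (groupsOf S k) {k}
  rw [Finset.card_singleton, Nat.cast_one, one_mul, add_comm] at hsources
  rw [← hsources]
  refine entropy_mono one_le_card (by fun_prop) fun ω ω' e => ?_
  simp only [Prod.mk.injEq, sources_eq_iff, subtuple_eq_iff, Finset.mem_singleton,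
    forall_eq] at e ⊢
  exact ⟨e.2, e.1.1⟩

lemma choose_mul_le_mul_H_msg₁ (h : 𝒮.IsSecureAggregation U) (hUK : U < K) (hK : 1 < K)
    (k : Fin K) : ((K - 1).choose U : ℝ) * L ≤
      ((K - 1).choose U - (K - S).choose U : ℕ) * 𝒮.H (𝒮.X k) := by
  set J := (Finset.univ.erase k).powersetCard U with hJ
  set m := (K - 1).choose U - (K - S).choose U
  let g (A : Finset (UserGroup K S)) : ℝ :=
    𝒮.H fun ω => ((𝒮.W k ω, 𝒮.X k ω), subtuple 𝒮.Z A ω)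
  have hshearer : m * (g (groupsOf S k) - g ∅) ≤ ∑ U₂ ∈ J, (g (groupsMeeting S k U₂) - g ∅) :=
    shearer_inequality g
      (entropy_prodMk_subtuple_submodular one_le_card (by fun_prop) 𝒮.measurable_Z)
      (fun U₂ _ => groupsMeeting_subset_groupsOf k U₂)
      (fun V hV => card_filter_mem_groupsMeeting (by simpa [groupsOf] using hV) U)
  have hempty : g ∅ = L + 𝒮.H (𝒮.X k) := by
    rw [← H_input_msg₁ h hUK hK k]
    change entropy _ _ _ = entropy _ _ _
    refine entropy_congr one_le_card (by fun_prop) (by fun_prop) ?_ ?_ <;>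
    · intro ω ω' e
      simp_all [subtuple_eq_iff]
  have hmeeting : ∀ U₂ ∈ J, g (groupsMeeting S k U₂) - g ∅ ≤
      ∑ V ∈ groupsMeeting S k U₂, 𝒮.H (𝒮.Z V) - L := by
    intro U₂ hU₂
    obtain ⟨hsub, hcard⟩ := Finset.mem_powersetCard.1 hU₂
    have := H_input_msg₁_groupsMeeting_le h (fun hk => Finset.notMem_erase k _ (hsub hk)) hcard.ge
    simp only [g, hempty] at *
    linarith
  have hJcard : (J.card : ℝ) = (K - 1).choose U := by
    simp [hJ, Finset.card_erase_of_mem]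
  have hgroupsOf := mul_le_mul_of_nonneg_left (le_H_input_msg₁_groupsOf h k) (Nat.cast_nonneg m)
  have hsum := hshearer.trans (Finset.sum_le_sum hmeeting)
  rw [Finset.sum_sub_distrib, sum_sum_groupsMeeting, Finset.sum_const, nsmul_eq_mul, hJcard,
    hempty] at hsum
  linarith

theorem choose_mul_le_sub_mul_H_msg₁ (h : 𝒮.IsSecureAggregation U) (hU : 1 ≤ U) (hUK : U < K)
    (hS : 1 ≤ S) (hSK : S ≤ K) (k : Fin K) :
    ((K - 1).choose (S - 1) : ℝ) * L ≤
      ((K - 1).choose (S - 1) - (K - 1 - U).choose (S - 1)) * 𝒮.H (𝒮.X k) := by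
  have hbound := choose_mul_le_mul_H_msg₁ h hUK (by omega) k
  rw [Nat.cast_sub (Nat.choose_le_choose U (by omega))] at hbound
  have hid : ((K - 1).choose U : ℝ) * (K - 1 - U).choose (S - 1) =
      (K - 1).choose (S - 1) * (K - S).choose U := by
    have := choose_mul_choose_sub_comm (K - 1) U (S - 1)
    rw [show K - 1 - (S - 1) = K - S by omega] at this
    exact_mod_cast this
  have hpos : (0 : ℝ) < (K - 1).choose U := by exact_mod_cast Nat.choose_pos (by omega)
  refine le_of_mul_le_mul_left ?_ hpos
  linear_combination ((K - 1).choose (S - 1) : ℝ) * hbound + 𝒮.H (𝒮.X k) * hid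

end Converse

end Scheme

/-! ### Linear algebra over large fields -/

section LinearAlgebra

variable {E : Type*} [Field E]

section Factorization

variable {W X Y ι : Type*} [AddCommGroup W] [Module E W] [AddCommGroup X] [Module E X]
  [AddCommGroup Y] [Module E Y]

lemma exists_comp_eq_of_ker_le {f : W →ₗ[E] X} {g : W →ₗ[E] Y}
    (h : LinearMap.ker g ≤ LinearMap.ker f) : ∃ φ : Y →ₗ[E] X, φ ∘ₗ g = f := by
  obtain ⟨φ, hφ⟩ := LinearMap.exists_extend
    ((LinearMap.ker g).liftQ f h ∘ₗ g.quotKerEquivRange.symm.toLinearMap)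
  refine ⟨φ, LinearMap.ext fun w => ?_⟩
  have hw : g.quotKerEquivRange.symm ⟨g w, g.mem_range_self w⟩ = Submodule.Quotient.mk w :=
    g.quotKerEquivRange_symm_apply_image w _
  simpa [hw] using LinearMap.congr_fun hφ ⟨g w, g.mem_range_self w⟩

lemma exists_eq_sum_of_forall_eq_zero (I : Finset ι) (f : W →ₗ[E] X) (g : ι → W →ₗ[E] Y)
    (h : ∀ w, (∀ i ∈ I, g i w = 0) → f w = 0) :
    ∃ φ : ι → Y →ₗ[E] X, ∀ w, f w = ∑ i ∈ I, φ i (g i w) := by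
  classical
  obtain ⟨φ, hφ⟩ := exists_comp_eq_of_ker_le (f := f) (g := LinearMap.pi fun i : I => g i)
    fun w hw => h w fun i hi => congrFun (LinearMap.mem_ker.1 hw) ⟨i, hi⟩
  replace hφ (w : W) : f w = φ fun i => g i w := (LinearMap.congr_fun hφ w).symm
  refine ⟨fun i => if hi : i ∈ I then φ ∘ₗ LinearMap.single E (fun _ => Y) ⟨i, hi⟩ else 0,
    fun w => ?_⟩
  rw [hφ, ← Finset.univ_sum_single fun i : I => g i w, map_sum, ← Finset.sum_coe_sort I]
  simp

end Factorization

section GenericInjectivity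

lemma totalDegree_det_le {R σ n : Type*} [CommRing R] [Fintype n] [DecidableEq n]
    {M : Matrix n n (MvPolynomial σ R)} (h : ∀ i j, (M i j).totalDegree ≤ 1) :
    M.det.totalDegree ≤ Fintype.card n := by
  rw [Matrix.det_apply]
  refine MvPolynomial.totalDegree_finsetSum_le fun τ _ => ?_
  calc (Equiv.Perm.sign τ • ∏ i, M (τ i) i).totalDegree
      ≤ (∏ i, M (τ i) i).totalDegree := MvPolynomial.totalDegree_smul_le _ _
    _ ≤ ∑ i, (M (τ i) i).totalDegree := MvPolynomial.totalDegree_finsetProd _ _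
    _ ≤ Fintype.card n := by simpa using Finset.sum_le_sum fun i (_ : i ∈ Finset.univ) => h (τ i) i

lemma exists_forall_eval_ne_zero [Fintype E] {σ η : Type*} [Finite σ] [Fintype η]
    {p : η → MvPolynomial σ E} {n : ℕ} (hp : ∀ e, p e ≠ 0) (hn : ∀ e, (p e).totalDegree ≤ n)
    (hE : Fintype.card η * n < Fintype.card E) : ∃ ξ : σ → E, ∀ e, (p e).eval ξ ≠ 0 := by
  have hprod : ∏ e, p e ≠ 0 := Finset.prod_ne_zero_iff.2 fun e _ => hp e
  contrapose! hprod
  refine MvPolynomial.eq_zero_of_eval_zero_at_prod_finset _ (fun _ => Finset.univ)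
    (fun i => ?_) fun ξ _ => ?_
  · calc (∏ e, p e).degreeOf i ≤ (∏ e, p e).totalDegree := MvPolynomial.degreeOf_le_totalDegree _ _
      _ ≤ ∑ e, (p e).totalDegree := MvPolynomial.totalDegree_finsetProd _ _
      _ ≤ Fintype.card η * n := by
        simpa using Finset.sum_le_sum fun e (_ : e ∈ Finset.univ) => hn e
      _ < (Finset.univ : Finset E).card := hE
  · obtain ⟨e, he⟩ := hprod ξ
    rw [map_prod]
    exact Finset.prod_eq_zero (Finset.mem_univ e) he

lemma exists_forall_injective [Fintype E] {Γ W X η : Type*} [AddCommGroup Γ] [Module E Γ]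
    [AddCommGroup W] [Module E W] [FiniteDimensional E W]
    [AddCommGroup X] [Module E X] [FiniteDimensional E X] [Fintype η]
    (A : η → Γ →ₗ[E] W →ₗ[E] X) (hWX : finrank E W = finrank E X)
    (hE : Fintype.card η * finrank E W < Fintype.card E)
    (h : ∀ e, ∃ γ, Function.Injective (A e γ)) : ∃ γ, ∀ e, Function.Injective (A e γ) := by
  choose γ hγ using h
  let b := finBasis E W
  let e := LinearEquiv.ofFinrankEq X W hWX.symm
  let M (i : η) (δ : Γ) := LinearMap.toMatrix b b (e.toLinearMap ∘ₗ A i δ)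
  have hM (i : η) (δ : Γ) : (M i δ).det ≠ 0 ↔ Function.Injective (A i δ) := by
    rw [LinearMap.det_toMatrix, ne_eq, LinearMap.det_eq_zero_iff_ker_ne_bot, not_not,
      LinearEquiv.ker_comp, LinearMap.ker_eq_bot]
  let p (i : η) : MvPolynomial η E :=
    (Matrix.of fun k l => ∑ j, MvPolynomial.C (M i (γ j) k l) * MvPolynomial.X j).det
  have hp (i : η) (ξ : η → E) : (p i).eval ξ = (M i (∑ j, ξ j • γ j)).det := by
    rw [RingHom.map_det]
    congr 1
    ext k l
    simp [M, LinearMap.toMatrix_apply, mul_comm]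
  have hp_ne (i : η) : p i ≠ 0 := fun hi => by
    classical
    refine (hM i (γ i)).2 (hγ i) ?_
    simpa [hi, Pi.single_apply, ite_smul] using (hp i (Pi.single i 1)).symm
  have hp_deg (i : η) : (p i).totalDegree ≤ finrank E W := by
    refine (totalDegree_det_le fun k l => ?_).trans_eq (Fintype.card_fin _)
    refine MvPolynomial.totalDegree_finsetSum_le fun j _ => ?_
    calc (MvPolynomial.C (M i (γ j) k l) * MvPolynomial.X j).totalDegree
        ≤ (MvPolynomial.C (M i (γ j) k l)).totalDegree + (MvPolynomial.X j).totalDegree :=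
          MvPolynomial.totalDegree_mul _ _
      _ = 1 := by simp
  obtain ⟨ξ, hξ⟩ := exists_forall_eval_ne_zero hp_ne hp_deg hE
  exact ⟨∑ j, ξ j • γ j, fun i => (hM i _).1 (hp i ξ ▸ hξ i)⟩

end GenericInjectivity

end LinearAlgebra

/-! ### Alternating forms -/

section AlternatingForms

variable {E V ι : Type*} [Field E] [AddCommGroup V] [Module E V] {s t : ℕ}

/-- The members of the family `v` indexed by the `s`-element set `T`, listed in some order. Only
the vanishing of alternating forms on this list matters, which does not depend on the order. -/
noncomputable def subfamily (v : ι → V) (T : {T : Finset ι // T.card = s}) (i : Fin s) : V :=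
  v ((T.1.equivFinOfCardEq T.2).symm i)

lemma map_comp_eq_zero_of_map_subfamily_eq_zero {ω : V [⋀^Fin s]→ₗ[E] E} {v : ι → V}
    {T : {T : Finset ι // T.card = s}} (h : ω (subfamily v T) = 0) {y : Fin s → ι}
    (hy : Function.Injective y) (hT : ∀ i, y i ∈ T.1) : ω (fun i => v (y i)) = 0 := by
  have hinj : Function.Injective fun i => (⟨y i, hT i⟩ : T.1) :=
    fun i j hij => hy (congrArg Subtype.val hij)
  let e := Equiv.ofBijective _ ((Fintype.bijective_iff_injective_and_card _).2
    ⟨hinj, by simp [T.2]⟩)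
  have he : (fun i => v (y i)) = subfamily v T ∘ e.trans (T.1.equivFinOfCardEq T.2) := by
    funext i
    simp [subfamily, e]
  rw [he, AlternatingMap.map_perm, h, smul_zero]

lemma eq_zero_of_forall_map_subfamily_eq_zero (b : Basis ι E V) {ω : V [⋀^Fin s]→ₗ[E] E}
    (h : ∀ T : {T : Finset ι // T.card = s}, ω (subfamily b T) = 0) : ω = 0 := by
  classical
  refine Basis.ext_alternating b fun y hy => ?_
  exact map_comp_eq_zero_of_map_subfamily_eq_zero
    (h ⟨Finset.univ.image y, by simp [Finset.card_image_of_injective _ hy]⟩) hy fun i => by simp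

/-- The contraction of alternating forms by a vector inserted in the first slot. -/
noncomputable def contract (x : V) : (V [⋀^Fin (t + 1)]→ₗ[E] E) →ₗ[E] V [⋀^Fin t]→ₗ[E] E :=
  AlternatingMap.curryLeftLinearMap.flip x

lemma contract_apply (x : V) (ω : V [⋀^Fin (t + 1)]→ₗ[E] E) (y : Fin t → V) :
    contract x ω y = ω (Fin.cons x y) := rfl

lemma map_eq_zero_of_contract_eq_zero {ω : V [⋀^Fin (t + 1)]→ₗ[E] E} {y : Fin (t + 1) → V}
    {i : Fin (t + 1)} (h : contract (y i) ω = 0) : ω y = 0 := by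
  rw [← i.insertNth_self_removeNth y, AlternatingMap.map_insertNth]
  exact (congrArg _ (DFunLike.congr_fun h (i.removeNth y))).trans (smul_zero _)

lemma contract_eq_zero_of_forall_map_subfamily_eq_zero {p : ι → Prop}
    (b : Basis {i // p i} E V) {v : ι → V} (hb : ∀ i, b i = v i) {j : ι} (hj : p j)
    {ω : V [⋀^Fin (t + 1)]→ₗ[E] E}
    (h : ∀ T : {T : Finset ι // T.card = t + 1}, j ∈ T.1 → (∀ i ∈ T.1, p i) →
      ω (subfamily v T) = 0) : contract (v j) ω = 0 := by
  classical
  refine Basis.ext_alternating b fun y hy => ?_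
  let z : Fin (t + 1) → ι := Fin.cons j fun i => y i
  have hz : (Fin.cons (v j) (fun i => b (y i)) : Fin (t + 1) → V) = fun i => v (z i) := by
    funext i
    refine Fin.cases ?_ (fun i => ?_) i <;> simp [z, hb]
  rw [contract_apply, hz, AlternatingMap.zero_apply]
  by_cases hjy : ∃ i, (y i : ι) = j
  · obtain ⟨i, hi⟩ := hjy
    exact ω.map_eq_zero_of_eq _ (i := 0) (j := i.succ) (by simp [z, hi]) (Fin.succ_ne_zero i).symm
  · have hz_inj : Function.Injective z :=
      Fin.cons_injective_iff.2 ⟨by simpa using hjy, Subtype.val_injective.comp hy⟩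
    refine map_comp_eq_zero_of_map_subfamily_eq_zero
      (h ⟨Finset.univ.image z, by simp [Finset.card_image_of_injective _ hz_inj]⟩ ?_ ?_)
      hz_inj fun i => by simp
    · exact Finset.mem_image.2 ⟨0, Finset.mem_univ _, rfl⟩
    · have hzp : ∀ i, p (z i) := Fin.cases hj fun i => (y i).2
      simpa using hzp

/-- The restriction of alternating forms to a subspace. -/
def restrictForms (N : Submodule E V) (s : ℕ) :
    (V [⋀^Fin s]→ₗ[E] E) →ₗ[E] N [⋀^Fin s]→ₗ[E] E where
  toFun ω := ω.compLinearMap N.subtype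
  map_add' ω ω' := AlternatingMap.add_compLinearMap ω ω' N.subtype
  map_smul' _ _ := rfl

/-- The alternating forms of degree `s` on `V` that vanish on the subspace `N`. -/
def RelForms (N : Submodule E V) (s : ℕ) : Type _ :=
  LinearMap.ker (restrictForms N s)

namespace RelForms

variable {N : Submodule E V}

instance : AddCommGroup (RelForms N s) :=
  inferInstanceAs (AddCommGroup (LinearMap.ker (restrictForms N s)))

instance : Module E (RelForms N s) :=
  inferInstanceAs (Module E (LinearMap.ker (restrictForms N s)))

/-- The inclusion of the relative forms into the forms. -/
def subtype (N : Submodule E V) (s : ℕ) : RelForms N s →ₗ[E] V [⋀^Fin s]→ₗ[E] E :=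
  (LinearMap.ker (restrictForms N s)).subtype

end RelForms

lemma restrictForms_surjective (N : Submodule E V) (s : ℕ) :
    Function.Surjective (restrictForms N s) := fun ω => by
  obtain ⟨π, hπ⟩ := N.subtype.exists_leftInverse_of_injective N.ker_subtype
  refine ⟨ω.compLinearMap π, AlternatingMap.ext fun y => ?_⟩
  exact congrArg ω (funext fun i => LinearMap.congr_fun hπ (y i))

instance [FiniteDimensional E V] : FiniteDimensional E (V [⋀^Fin s]→ₗ[E] E) :=
  Module.Finite.equiv exteriorPower.alternatingMapLinearEquiv.symm

instance {N : Submodule E V} [FiniteDimensional E V] : FiniteDimensional E (RelForms N s) :=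
  inferInstanceAs (FiniteDimensional E (LinearMap.ker (restrictForms N s)))

lemma finrank_alternatingMap [FiniteDimensional E V] :
    finrank E (V [⋀^Fin s]→ₗ[E] E) = (finrank E V).choose s := by
  rw [exteriorPower.alternatingMapLinearEquiv.finrank_eq, finrank_linearMap_self,
    exteriorPower.finrank_eq]

lemma finrank_relForms [FiniteDimensional E V] (N : Submodule E V) :
    finrank E (RelForms N s) = (finrank E V).choose s - (finrank E N).choose s := by
  have h := (restrictForms N s).finrank_range_add_finrank_ker
  rw [LinearMap.range_eq_top.2 (restrictForms_surjective N s), finrank_top,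
    finrank_alternatingMap, finrank_alternatingMap] at h
  exact Nat.eq_sub_of_add_eq' h

lemma RelForms.map_eq_zero {N : Submodule E V} (ω : RelForms N s) {y : Fin s → V}
    (hy : ∀ i, y i ∈ N) : ω.1 y = 0 :=
  DFunLike.congr_fun (LinearMap.mem_ker.1 ω.2) fun i => (⟨y i, hy i⟩ : N)

end AlternatingForms

/-! ### Linear codes for secure aggregation -/

/-- The `s`-element subsets of `Fin U ⊕ Fin r` that meet `Fin U`; they index the coordinates of an
alternating form that vanishes on the span of the last `r` vectors of a basis. -/
abbrev HitSet (U r s : ℕ) : Type :=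
  {M : Finset (Fin U ⊕ Fin r) // M.card = s ∧ ∃ u, Sum.inl u ∈ M}

namespace HitSet

variable {U r s : ℕ}

lemma card : Fintype.card (HitSet U r s) = (U + r).choose s - r.choose s := by
  have hall : ((Finset.univ : Finset (Fin U ⊕ Fin r)).powersetCard s).card = (U + r).choose s := by
    simp
  have hmiss : ((Finset.univ.map (Function.Embedding.inr : Fin r ↪ Fin U ⊕ Fin r)).powersetCard
      s).card = r.choose s := by
    simp
  rw [← hall, ← hmiss, ← Finset.card_sdiff_of_subset
    (Finset.powersetCard_mono (Finset.subset_univ _)), Fintype.card_subtype]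
  congr 1
  ext M
  have hM : (∃ u, Sum.inl u ∈ M) ↔
      ¬ M ⊆ Finset.univ.map (Function.Embedding.inr : Fin r ↪ Fin U ⊕ Fin r) := by
    simp [Finset.subset_iff]
  simp only [Finset.mem_filter, Finset.mem_univ, true_and, Finset.mem_sdiff,
    Finset.mem_powersetCard, Finset.subset_univ, hM]
  tauto

variable [NeZero U]

/-- Cyclic rotation by `τ` of the first summand. -/
def rotate (τ : Fin U) (M : HitSet U r s) : HitSet U r s :=
  ⟨M.1.map (Equiv.sumCongr (Equiv.addRight τ) (Equiv.refl _)).toEmbedding, by simp [M.2.1],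
    M.2.2.imp' (· + τ) fun u hu => by simpa using hu⟩

lemma inl_add_mem_rotate {τ u : Fin U} {M : HitSet U r s} (hu : Sum.inl u ∈ M.1) :
    Sum.inl (u + τ) ∈ (M.rotate τ).1 := by
  simpa [rotate] using hu

lemma rotate_rotate_neg (τ : Fin U) (M : HitSet U r s) : (M.rotate (-τ)).rotate τ = M := by
  ext (u | m) <;> simp [rotate]

end HitSet

lemma exists_injective_comp_of_coord {E W Y : Type*} [Field E] [AddCommGroup W] [Module E W]
    [AddCommGroup Y] [Module E Y] {U r s : ℕ} [NeZero U] {D : Fin U → W →ₗ[E] Y}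
    (coord : HitSet U r s → Fin U → W →ₗ[E] E)
    (hD : ∀ u M, Sum.inl u ∈ M.1 → ∀ w, D u w = 0 → ∀ β, coord M β w = 0)
    (hcoord : ∀ w, (∀ M β, coord M β w = 0) → w = 0) :
    ∃ γ : Fin U → Y →ₗ[E] HitSet U r s → E,
      Function.Injective (LinearMap.pi fun u => γ u ∘ₗ D u) := by
  choose f hf using fun M : HitSet U r s => M.2.2
  -- `M.rotate (u - f M)` contains `inl u`, so `D u` determines its coordinates; letting `u` vary
  -- with `M` fixed, each of the `U` coordinates of every rotation class is read once.
  let read (u : Fin U) : W →ₗ[E] HitSet U r s → E :=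
    LinearMap.pi fun M => coord (M.rotate (u - f M)) (u - f M)
  have hread (u : Fin U) : LinearMap.ker (D u) ≤ LinearMap.ker (read u) :=
    fun w hw => funext fun M => by
      have hu : Sum.inl u ∈ (M.rotate (u - f M)).1 := by
        simpa using HitSet.inl_add_mem_rotate (τ := u - f M) (hf M)
      exact hD u _ hu w hw _
  choose γ hγ using fun u => exists_comp_eq_of_ker_le (hread u)
  refine ⟨γ, (injective_iff_map_eq_zero _).2 fun w hw => hcoord w fun M β => ?_⟩
  have hM := congrFun (congrFun hw (f (M.rotate (-β)) + β)) (M.rotate (-β))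
  rw [LinearMap.pi_apply, hγ] at hM
  simpa only [read, LinearMap.pi_apply, add_sub_cancel_left, HitSet.rotate_rotate_neg,
    Pi.zero_apply] using hM

/-- Linear maps from which an aggregation scheme is built, for inputs in `W`: `share k V` is the
part of the input of user `k` that is sent masked with the key of the group `V`, and `combine j` is
what the second-round message of user `j` reveals of the sum of the inputs. By `combine_eq`, this is
a function of the shares in the groups containing `j`, whose masks user `j` knows; by `eq_zero`,
the messages of `U` users determine the sum. -/
structure LinearCode (F : Type*) [Field F] (K U S : ℕ) (W P C : Type*)
    [AddCommGroup W] [Module F W] [AddCommGroup P] [Module F P] [AddCommGroup C] [Module F C] where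
  share (k : Fin K) : {V : UserGroup K S // k ∈ V.1} → W →ₗ[F] P
  combine : Fin K → W →ₗ[F] C
  recover (j k : Fin K) : {V : UserGroup K S // k ∈ V.1} → P →ₗ[F] C
  combine_eq (j k : Fin K) : j ≠ k → ∀ w,
    combine j w = ∑ V : {V : UserGroup K S // k ∈ V.1} with j ∈ V.1.1,
      recover j k V (share k V w)
  eq_zero (U₂ : Finset (Fin K)) : U ≤ U₂.card → ∀ w, (∀ j ∈ U₂, combine j w = 0) → w = 0

section LayeredForms

variable {E V : Type*} [Field E] [AddCommGroup V] [Module E V] {K U r t : ℕ}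
  (N : Submodule E V)

/-- Layerwise contraction of `U`-tuples of relative forms. -/
noncomputable def layerContract (U t : ℕ) (x : V) :
    (Fin U → RelForms N (t + 1)) →ₗ[E] Fin U → V [⋀^Fin t]→ₗ[E] E :=
  (contract x ∘ₗ RelForms.subtype N (t + 1)).compLeft (Fin U)

/-- Evaluation of relative forms at the vectors `y`. -/
def relEval {s : ℕ} (y : Fin s → V) : RelForms N s →ₗ[E] E where
  toFun ω := ω.1 y
  map_add' _ _ := rfl
  map_smul' _ _ := rfl

/-- Layerwise evaluation of `U`-tuples of relative forms on the members of `v` indexed by `V`,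
with `k` left out. -/
noncomputable def layerShare (U : ℕ) (v : Fin K → V) (k : Fin K)
    (T : {T : UserGroup K (t + 2) // k ∈ T.1}) : (Fin U → RelForms N (t + 1)) →ₗ[E] Fin U → E :=
  (relEval N (subfamily v ⟨T.1.1.erase k, by
    rw [Finset.card_erase_of_mem T.2, T.1.2, Nat.add_succ_sub_one]⟩)).compLeft (Fin U)

variable {N}

lemma layerContract_eq_zero_of_forall_layerShare_eq_zero {v : Fin K → V} {j k : Fin K}
    (hjk : j ≠ k) (b : Basis {i // i ≠ k} E V) (hb : ∀ i, b i = v i)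
    {w : Fin U → RelForms N (t + 1)}
    (h : ∀ T : {T : UserGroup K (t + 2) // k ∈ T.1}, j ∈ T.1.1 → layerShare N U v k T w = 0) :
    layerContract N U t (v j) w = 0 := by
  funext β
  refine contract_eq_zero_of_forall_map_subfamily_eq_zero b hb hjk fun T hj hk => ?_
  have hkT : k ∉ T.1 := fun hk' => hk k hk' rfl
  have hT : (insert k T.1).card = t + 2 := by rw [Finset.card_insert_of_notMem hkT, T.2]
  have hTk : T = ⟨(insert k T.1).erase k, by rw [Finset.erase_insert hkT, T.2]⟩ :=
    Subtype.ext (Finset.erase_insert hkT).symm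
  rw [hTk]
  exact congrFun (h ⟨⟨insert k T.1, hT⟩, Finset.mem_insert_self k T.1⟩
    (Finset.mem_insert_of_mem hj)) β

/-- The value of the layer `β` of a `U`-tuple of relative forms on the vectors of the basis `b`
indexed by `M`. -/
noncomputable def layerCoord (b : Basis (Fin U ⊕ Fin r) E V) (M : HitSet U r (t + 1)) (β : Fin U) :
    (Fin U → RelForms N (t + 1)) →ₗ[E] E :=
  relEval N (subfamily b ⟨M.1, M.2.1⟩) ∘ₗ LinearMap.proj β

lemma layerCoord_apply (b : Basis (Fin U ⊕ Fin r) E V) (M : HitSet U r (t + 1)) (β : Fin U)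
    (w : Fin U → RelForms N (t + 1)) :
    layerCoord b M β w = (w β).1 (subfamily b ⟨M.1, M.2.1⟩) :=
  rfl

lemma layerCoord_eq_zero_of_layerContract_eq_zero {b : Basis (Fin U ⊕ Fin r) E V} {u : Fin U}
    {M : HitSet U r (t + 1)} (hu : Sum.inl u ∈ M.1) {w : Fin U → RelForms N (t + 1)}
    (h : layerContract N U t (b (Sum.inl u)) w = 0) (β : Fin U) : layerCoord b M β w = 0 := by
  rw [layerCoord_apply]
  refine map_eq_zero_of_contract_eq_zero (i := Finset.equivFinOfCardEq M.2.1 ⟨_, hu⟩) ?_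
  have hb : subfamily b ⟨M.1, M.2.1⟩ (Finset.equivFinOfCardEq M.2.1 ⟨_, hu⟩) = b (Sum.inl u) := by
    simp [subfamily]
  rw [hb]
  exact congrFun h β

lemma eq_zero_of_forall_layerCoord_eq_zero {b : Basis (Fin U ⊕ Fin r) E V}
    (hbN : ∀ m, b (Sum.inr m) ∈ N) {w : Fin U → RelForms N (t + 1)}
    (h : ∀ M β, layerCoord b M β w = 0) : w = 0 := by
  refine funext fun β => Subtype.ext (eq_zero_of_forall_map_subfamily_eq_zero b fun T => ?_)
  by_cases hT : ∃ u, Sum.inl u ∈ T.1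
  · exact h ⟨T.1, T.2, hT⟩ β
  · refine (w β).map_eq_zero fun i => ?_
    rw [subfamily]
    rcases hi : ((Finset.equivFinOfCardEq T.2).symm i).1 with u | m
    · exact absurd ⟨u, hi ▸ Subtype.prop _⟩ hT
    · exact hbN m

lemma exists_injective_comp_layerContract [NeZero U] {b : Basis (Fin U ⊕ Fin r) E V}
    (hbN : ∀ m, b (Sum.inr m) ∈ N) :
    ∃ γ : Fin U → (Fin U → V [⋀^Fin t]→ₗ[E] E) →ₗ[E] HitSet U r (t + 1) → E,
      Function.Injective (LinearMap.pi fun u => γ u ∘ₗ layerContract N U t (b (Sum.inl u))) :=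
  exists_injective_comp_of_coord (W := Fin U → RelForms N (t + 1)) (layerCoord (N := N) b)
    (fun _ _ hu _ h => layerCoord_eq_zero_of_layerContract_eq_zero hu h)
    fun _ h => eq_zero_of_forall_layerCoord_eq_zero hbN h

end LayeredForms

lemma exists_forall_injective_pi_comp {E ι κ W Y C : Type*} [Field E] [Fintype E] [Fintype ι]
    [Fintype κ] [AddCommGroup W] [Module E W] [FiniteDimensional E W] [AddCommGroup Y] [Module E Y]
    [AddCommGroup C] [Module E C] [FiniteDimensional E C] {D : κ → W →ₗ[E] Y}
    (hWC : finrank E W = Fintype.card ι * finrank E C)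
    (hE : Fintype.card (ι ↪ κ) * finrank E W < Fintype.card E)
    (h : ∀ ε : ι ↪ κ, ∃ γ : ι → Y →ₗ[E] C,
      Function.Injective (LinearMap.pi fun i => γ i ∘ₗ D (ε i))) :
    ∃ γ : κ → Y →ₗ[E] C, ∀ ε : ι ↪ κ,
      Function.Injective (LinearMap.pi fun i => γ (ε i) ∘ₗ D (ε i)) := by
  let A (ε : ι ↪ κ) : (κ → Y →ₗ[E] C) →ₗ[E] W →ₗ[E] ι → C :=
    { toFun γ := LinearMap.pi fun i => γ (ε i) ∘ₗ D (ε i)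
      map_add' _ _ := rfl
      map_smul' _ _ := rfl }
  refine exists_forall_injective A (by rw [hWC, finrank_pi_fintype]; simp) hE fun ε => ?_
  obtain ⟨γ, hγ⟩ := h ε
  refine ⟨Function.extend ε γ 0, ?_⟩
  change Function.Injective (LinearMap.pi fun i => Function.extend ε γ 0 (ε i) ∘ₗ D (ε i))
  simpa only [ε.injective.extend_apply] using hγ

section Vandermonde

variable {E : Type*} [Field E] {K U r t : ℕ}

/-- The vector `(1, x, x², …)` of length `U + r`. -/
def powerVec (U r : ℕ) (x : E) (m : Fin U ⊕ Fin r) : E :=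
  x ^ (finSumFinEquiv m : ℕ)

lemma eq_zero_of_forall_sum_mul_pow_eq_zero {ι : Type*} [Fintype ι] {x : ι → E}
    (hx : Function.Injective x) {c : ι → E}
    (h : ∀ m < Fintype.card ι, ∑ i, c i * x i ^ m = 0) : c = 0 := by
  let e := Fintype.equivFin ι
  have hc : c ∘ e.symm = 0 := Matrix.eq_zero_of_forall_pow_sum_mul_pow_eq_zero (f := x ∘ e.symm)
    (hx.comp e.symm.injective) fun m => by
      rw [← h m m.2]
      exact Equiv.sum_comp e.symm fun i => c i * x i ^ (m : ℕ)
  exact funext fun i => by simpa using congrFun hc (e i)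

lemma linearIndependent_powerVec {ι : Type*} [Fintype ι] {x : ι → E}
    (hx : Function.Injective x) (hι : Fintype.card ι = U + r) :
    LinearIndependent E fun i => powerVec U r (x i) := by
  rw [Fintype.linearIndependent_iff]
  refine fun c hc => congrFun (eq_zero_of_forall_sum_mul_pow_eq_zero hx fun m hm => ?_)
  simpa [powerVec] using congrFun hc (finSumFinEquiv.symm ⟨m, hι ▸ hm⟩)

/-- The subspace of `E ^ (U + r)` spanned by the last `r` coordinate vectors. -/
def tailSpace (E : Type*) [Field E] (U r : ℕ) : Submodule E (Fin U ⊕ Fin r → E) :=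
  LinearMap.ker (LinearMap.funLeft E E (Sum.inl : Fin U → Fin U ⊕ Fin r))

lemma finrank_tailSpace : finrank E (tailSpace E U r) = r := by
  have h := (LinearMap.funLeft E E (Sum.inl : Fin U → Fin U ⊕ Fin r)).finrank_range_add_finrank_ker
  rw [LinearMap.range_eq_top.2 (LinearMap.funLeft_surjective_of_injective E E _
    Sum.inl_injective), finrank_top, finrank_fin_fun, finrank_fintype_fun_eq_card,
    Fintype.card_sum, Fintype.card_fin, Fintype.card_fin] at h
  exact Nat.add_left_cancel h

lemma exists_basis_powerVec_tailSpace {x : Fin U → E} (hx : Function.Injective x) :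
    ∃ b : Basis (Fin U ⊕ Fin r) E (Fin U ⊕ Fin r → E),
      (∀ u, b (Sum.inl u) = powerVec U r (x u)) ∧ ∀ m, b (Sum.inr m) ∈ tailSpace E U r := by
  let v : Fin U ⊕ Fin r → Fin U ⊕ Fin r → E :=
    Sum.elim (fun u => powerVec U r (x u)) fun m => Pi.single (Sum.inr m) 1
  have hv : LinearIndependent E v := by
    rw [Fintype.linearIndependent_iff]
    intro c hc
    rw [Fintype.sum_sum_type] at hc
    have hl : (fun u => c (Sum.inl u)) = 0 :=
      eq_zero_of_forall_sum_mul_pow_eq_zero hx fun m hm => by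
        simpa [v, powerVec] using congrFun hc (Sum.inl ⟨m, by simpa using hm⟩)
    rintro (u | m)
    · exact congrFun hl u
    · simpa [v, congrFun hl, Pi.single_apply] using congrFun hc (Sum.inr m)
  refine ⟨basisOfLinearIndependentOfCardEqFinrank' v hv (by simp), fun u => ?_, fun m => ?_⟩
  · simp [v]
  · ext u
    simp [v, LinearMap.funLeft]

end Vandermonde

section ExteriorCode

variable {E V : Type*} [Field E] [AddCommGroup V] [Module E V] {K U r t : ℕ} {N : Submodule E V}

lemma nonempty_linearCode_of_injective {v : Fin K → V}
    (hv : ∀ k, ∃ b : Basis {i // i ≠ k} E V, ∀ i, b i = v i.1) {C : Type*} [AddCommGroup C]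
    [Module E C] {γ : Fin K → (Fin U → V [⋀^Fin t]→ₗ[E] E) →ₗ[E] C}
    (hγ : ∀ ε : Fin U ↪ Fin K, Function.Injective
      (LinearMap.pi fun u => γ (ε u) ∘ₗ layerContract N U t (v (ε u)))) :
    Nonempty (LinearCode E K U (t + 2) (Fin U → RelForms N (t + 1)) (Fin U → E) C) := by
  have hrec (j k : Fin K) : ∃ φ : {T : UserGroup K (t + 2) // k ∈ T.1} → (Fin U → E) →ₗ[E] C,
      j ≠ k → ∀ w, (γ j ∘ₗ layerContract N U t (v j)) w =
        ∑ T : {T : UserGroup K (t + 2) // k ∈ T.1} with j ∈ T.1.1,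
          φ T (layerShare N U v k T w) := by
    by_cases hjk : j = k
    · exact ⟨0, fun h => absurd hjk h⟩
    obtain ⟨b, hb⟩ := hv k
    obtain ⟨φ, hφ⟩ := exists_eq_sum_of_forall_eq_zero
      {T : {T : UserGroup K (t + 2) // k ∈ T.1} | j ∈ T.1.1}
      (γ j ∘ₗ layerContract N U t (v j)) (layerShare N U v k) fun w hw => by
        rw [LinearMap.comp_apply, layerContract_eq_zero_of_forall_layerShare_eq_zero hjk b hb
          fun T hT => hw T (by simpa using hT), map_zero]
    exact ⟨φ, fun _ => hφ⟩
  choose recover hrecover using hrec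
  refine ⟨⟨layerShare N U v, fun j => γ j ∘ₗ layerContract N U t (v j), recover, hrecover,
    fun U₂ hU₂ w hw => ?_⟩⟩
  let ε := Finset.orderEmbOfCardLe U₂ hU₂
  refine (injective_iff_map_eq_zero _).1 (hγ ε.toEmbedding) w (funext fun u => hw _ ?_)
  exact Finset.orderEmbOfCardLe_mem U₂ hU₂ u

lemma finrank_layers [FiniteDimensional E V] :
    finrank E (Fin U → RelForms N t) =
      U * ((finrank E V).choose t - (finrank E N).choose t) := by
  rw [finrank_pi_fintype E (M := fun _ : Fin U => RelForms N t), finrank_relForms]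
  simp

lemma nonempty_linearCode_of_card_lt [Fintype E] [NeZero U] {x : Fin (U + r + 1) → E}
    (hx : Function.Injective x)
    (hE : (U + r + 1).descFactorial U * (U * ((U + r).choose (t + 1) - r.choose (t + 1))) <
      Fintype.card E) :
    Nonempty (LinearCode E (U + r + 1) U (t + 2)
      (Fin U → RelForms (tailSpace E U r) (t + 1)) (Fin U → E) (HitSet U r (t + 1) → E)) := by
  have hW : finrank E (Fin U → RelForms (tailSpace E U r) (t + 1)) =
      U * ((U + r).choose (t + 1) - r.choose (t + 1)) := by
    simp [finrank_layers, finrank_tailSpace]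
  have hv (k : Fin (U + r + 1)) : ∃ b : Basis {i // i ≠ k} E (Fin U ⊕ Fin r → E),
      ∀ i, b i = powerVec U r (x i) :=
    ⟨basisOfLinearIndependentOfCardEqFinrank' _ (linearIndependent_powerVec
      (hx.comp Subtype.val_injective) (by simp)) (by simp), fun i => by simp⟩
  obtain ⟨γ, hγ⟩ := exists_forall_injective_pi_comp (ι := Fin U)
    (W := Fin U → RelForms (tailSpace E U r) (t + 1)) (C := HitSet U r (t + 1) → E)
    (D := fun j => layerContract (tailSpace E U r) U t (powerVec U r (x j)))
    (by rw [hW, finrank_fintype_fun_eq_card, HitSet.card, Fintype.card_fin])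
    (by simpa [hW, Fintype.card_embedding_eq] using hE) fun ε => by
      obtain ⟨b, hb, hbN⟩ := exists_basis_powerVec_tailSpace (r := r) (hx.comp ε.injective)
      simpa only [hb, Function.comp_apply] using exists_injective_comp_layerContract (t := t) hbN
  exact nonempty_linearCode_of_injective (v := fun i => powerVec U r (x i)) hv hγ

end ExteriorCode

namespace LinearCode

variable {F E : Type*} [Field F] [Field E] [Algebra F E] {K U S : ℕ}
  {W P C W' P' C' : Type*} [AddCommGroup W] [Module E W] [Module F W] [IsScalarTower F E W]
  [AddCommGroup P] [Module E P] [Module F P] [IsScalarTower F E P]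
  [AddCommGroup C] [Module E C] [Module F C] [IsScalarTower F E C]
  [AddCommGroup W'] [Module F W'] [AddCommGroup P'] [Module F P'] [AddCommGroup C'] [Module F C']

/-- A code over an extension `E` of `F`, regarded as a code over `F` and carried over to other
coordinates. -/
def transport (c : LinearCode E K U S W P C) (eW : W ≃ₗ[F] W') (eP : P ≃ₗ[F] P')
    (eC : C ≃ₗ[F] C') : LinearCode F K U S W' P' C' where
  share k V := eP.toLinearMap ∘ₗ (c.share k V).restrictScalars F ∘ₗ eW.symm.toLinearMap
  combine j := eC.toLinearMap ∘ₗ (c.combine j).restrictScalars F ∘ₗ eW.symm.toLinearMap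
  recover j k V := eC.toLinearMap ∘ₗ (c.recover j k V).restrictScalars F ∘ₗ eP.symm.toLinearMap
  combine_eq j k hjk w := by simp [c.combine_eq j k hjk]
  eq_zero U₂ hU₂ w h := by
    simpa using c.eq_zero U₂ hU₂ (eW.symm w) fun j hj => by simpa using h j hj

end LinearCode

lemma exists_extension_lt_card (F : Type*) [Field F] [Finite F] (m₀ n : ℕ) :
    ∃ (E : Type) (_ : Field E) (_ : Fintype E) (_ : Algebra F E),
      m₀ ≤ finrank F E ∧ n < Fintype.card E := by
  obtain ⟨p, hp⟩ := CharP.exists F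
  have : Fact p.Prime := ⟨CharP.char_is_prime F p⟩
  let m := m₀ + n + 1
  refine ⟨FiniteField.Extension F p m, inferInstance, Fintype.ofFinite _, inferInstance, ?_, ?_⟩
  · rw [FiniteField.finrank_extension]
    omega
  · rw [Fintype.card_eq_nat_card, FiniteField.natCard_extension]
    exact (show n < m by omega).trans (Nat.lt_pow_self Finite.one_lt_card)

theorem exists_linearCode (F : Type*) [Field F] [Finite F] {K U S : ℕ} (hU : 1 ≤ U)
    (hUK : U < K) (hS : 2 ≤ S) (m₀ : ℕ) :
    ∃ m, m₀ ≤ m ∧ Nonempty (LinearCode F K U S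
      (Fin (((K - 1).choose (S - 1) - (K - 1 - U).choose (S - 1)) * (U * m)) → F)
      (Fin (U * m) → F)
      (Fin (((K - 1).choose (S - 1) - (K - 1 - U).choose (S - 1)) * m) → F)) := by
  have : NeZero U := ⟨by omega⟩
  obtain ⟨t, rfl⟩ : ∃ t, S = t + 2 := ⟨S - 2, by omega⟩
  obtain ⟨r, rfl⟩ : ∃ r, K = U + r + 1 := ⟨K - 1 - U, by omega⟩
  have hr : U + r + 1 - 1 - U = r := by omega
  rw [hr, Nat.add_sub_cancel, Nat.add_succ_sub_one]
  set d := (U + r).choose (t + 1) - r.choose (t + 1) with hd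
  obtain ⟨E, _, _, _, hm, hE⟩ := exists_extension_lt_card F m₀
    ((U + r + 1) + (U + r + 1).descFactorial U * (U * d))
  obtain ⟨x⟩ : Nonempty (Fin (U + r + 1) ↪ E) :=
    Function.Embedding.nonempty_of_card_le (by rw [Fintype.card_fin]; omega)
  obtain ⟨c⟩ := nonempty_linearCode_of_card_lt (t := t) x.injective
    (lt_of_le_of_lt (Nat.le_add_left _ _) hE)
  let c' : LinearCode E (U + r + 1) U (t + 2) (Fin (d * U) → E) (Fin U → E)
      (HitSet U r (t + 1) → E) :=
    c.transport (LinearEquiv.ofFinrankEq _ _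
      (by simp [finrank_layers, finrank_tailSpace, hd, mul_comm])) (.refl E _) (.refl E _)
  exact ⟨finrank F E, hm, ⟨c'.transport
    (LinearEquiv.ofFinrankEq _ _ (by simp [finrank_pi_fintype, mul_assoc]))
    (LinearEquiv.ofFinrankEq _ _ (by simp [finrank_pi_fintype]))
    (LinearEquiv.ofFinrankEq _ _ (by simp [finrank_pi_fintype, HitSet.card, hd]))⟩⟩

/-! ### The aggregation scheme of a linear code -/

section DiscreteSampleSpace

variable {Ω α β γ δ : Type*} [MeasurableSpace Ω] [DiscreteMeasurableSpace Ω] {μ : Measure Ω}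
  [IsProbabilityMeasure μ] {b : ℝ} [Fintype α] [Fintype β] [Fintype γ] [Fintype δ]

lemma condEntropy_eq_zero_of_factorsThrough (hb : 1 ≤ b) {A : Ω → α} {B : Ω → β}
    (h : A.FactorsThrough B) : condEntropy b μ A B = 0 := by
  let _ : MeasurableSpace α := ⊤
  let _ : MeasurableSpace β := ⊤
  exact sub_eq_zero.2 <| entropy_congr hb .of_discrete .of_discrete
    (fun _ _ e => Prod.ext (h e) e) fun _ _ e => congrArg Prod.snd e

/-- Once `T` is known, `M` carries the same information as `R`, which is independent of `A`. -/
lemma condMutualInfo_eq_zero_of_entropyIndep (hb : 1 ≤ b) {A : Ω → α} {M : Ω → β} {T : Ω → γ}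
    {R : Ω → δ} (hindep : EntropyIndep b μ A R) (hTA : T.FactorsThrough A)
    (hRM : R.FactorsThrough M) (hMRT : M.FactorsThrough fun ω => (R ω, T ω)) :
    condMutualInfo b μ A M T = 0 := by
  let _ : MeasurableSpace α := ⊤
  let _ : MeasurableSpace β := ⊤
  let _ : MeasurableSpace γ := ⊤
  let _ : MeasurableSpace δ := ⊤
  have hAT : entropy b μ (fun ω => (A ω, T ω)) = entropy b μ A :=
    entropy_congr hb .of_discrete .of_discrete (fun _ _ e => Prod.ext e (hTA e))
      fun _ _ e => congrArg Prod.fst e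
  have hAMT : entropy b μ (fun ω => (A ω, M ω, T ω)) = entropy b μ (fun ω => (A ω, R ω)) := by
    refine entropy_congr hb .of_discrete .of_discrete (fun ω ω' e => ?_) fun ω ω' e => ?_
    · obtain ⟨eA, eR⟩ := Prod.mk.inj e
      exact Prod.ext eA (Prod.ext (hMRT (Prod.ext eR (hTA eA))) (hTA eA))
    · obtain ⟨eA, eMT⟩ := Prod.mk.inj e
      exact Prod.ext eA (hRM (congrArg Prod.fst eMT))
  have hMT : entropy b μ (fun ω => (M ω, T ω)) = entropy b μ (fun ω => (R ω, T ω)) := by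
    refine entropy_congr hb .of_discrete .of_discrete (fun ω ω' e => ?_) fun ω ω' e => ?_
    · exact Prod.ext (hMRT e) (Prod.mk.inj e).2
    · exact Prod.ext (hRM (Prod.mk.inj e).1) (Prod.mk.inj e).2
  have hTR : EntropyIndep b μ T R := hindep.of_determined_left hb .of_discrete .of_discrete
    .of_discrete (determined_of_factorsThrough hb .of_discrete hTA)
  have hRT := hTR.symm hb .of_discrete .of_discrete
  have hle_AR : entropy b μ (fun ω => (A ω, R ω)) ≤ entropy b μ A + entropy b μ R :=
    entropy_prodMk_le hb .of_discrete .of_discrete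
  have hle_RT : entropy b μ (fun ω => (R ω, T ω)) ≤ entropy b μ R + entropy b μ T :=
    entropy_prodMk_le hb .of_discrete .of_discrete
  unfold condMutualInfo condEntropy
  unfold EntropyIndep at hindep hRT
  rw [hAT, hAMT, hMT]
  linarith

end DiscreteSampleSpace

section Uniform

open ProbabilityTheory

lemma uniformOn_real_preimage_singleton {G H : Type*} [AddGroup G] [Finite G] [MeasurableSpace G]
    [DiscreteMeasurableSpace G] [AddGroup H] [Fintype H] {A : G →+ H}
    (hA : Function.Surjective A) (a : H) :
    (uniformOn (Set.univ : Set G)).real (A ⁻¹' {a}) = 1 / Fintype.card H := by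
  classical
  have := Fintype.ofFinite G
  have hreal : (uniformOn (Set.univ : Set G)).real (A ⁻¹' {a}) =
      ({g | A g = a} : Finset G).card / Fintype.card G := by
    rw [Measure.real, uniformOn_univ,
      show A ⁻¹' {a} = (({g | A g = a} : Finset G) : Set G) by ext; simp,
      Measure.count_apply_finset]
    simp
  have hcard : Fintype.card G = Fintype.card H * ({g | A g = a} : Finset G).card := by
    rw [← Finset.card_univ, Finset.card_eq_sum_card_fiberwise (f := A) (t := Finset.univ) (by simp),
      Finset.sum_congr rfl fun a' _ => AddMonoidHom.card_fiber_eq_of_mem_range A (hA a') (hA a)]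
    simp
  rw [hreal, div_eq_div_iff (Nat.cast_ne_zero.2 Fintype.card_ne_zero)
    (Nat.cast_ne_zero.2 Fintype.card_ne_zero), hcard]
  push_cast
  ring

variable {F Ω M N : Type*} [Field F] [Fintype F] [AddCommGroup Ω] [Module F Ω] [Finite Ω]
  [MeasurableSpace Ω] [DiscreteMeasurableSpace Ω]
  [AddCommGroup M] [Module F M] [Fintype M] [AddCommGroup N] [Module F N] [Fintype N]

lemma entropy_uniformOn_eq_finrank {A : Ω →ₗ[F] M} (hA : Function.Surjective A) :
    entropy (Fintype.card F) (uniformOn (Set.univ : Set Ω)) A = finrank F M := by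
  have hlog : Real.log (Fintype.card F) ≠ 0 :=
    (Real.log_pos (by exact_mod_cast Fintype.one_lt_card)).ne'
  have hcard : Real.log (Fintype.card M) = finrank F M * Real.log (Fintype.card F) := by
    rw [card_eq_pow_finrank (K := F) (V := M), Nat.cast_pow, Real.log_pow]
  have hpos : (Fintype.card M : ℝ) ≠ 0 := Nat.cast_ne_zero.2 Fintype.card_ne_zero
  have huniform (a : M) : (uniformOn (Set.univ : Set Ω)).real (A ⁻¹' {a}) = 1 / Fintype.card M :=
    uniformOn_real_preimage_singleton (A := A.toAddMonoidHom) hA a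
  simp only [entropy, huniform, Finset.sum_const, Finset.card_univ, nsmul_eq_mul, Real.negMulLog,
    one_div, Real.log_inv, hcard]
  field_simp

lemma entropyIndep_uniformOn {A : Ω →ₗ[F] M} {B : Ω →ₗ[F] N}
    (h : Function.Surjective (A.prod B)) :
    EntropyIndep (Fintype.card F) (uniformOn (Set.univ : Set Ω)) A B := by
  have hA : Function.Surjective A := Prod.fst_surjective.comp h
  have hB : Function.Surjective B := Prod.snd_surjective.comp h
  have hAB := entropy_uniformOn_eq_finrank h
  rw [finrank_prod, Nat.cast_add] at hAB
  unfold EntropyIndep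
  rw [entropy_uniformOn_eq_finrank hA, entropy_uniformOn_eq_finrank hB]
  exact hAB.ge

end Uniform

lemma card_groups_of_mem {K S : ℕ} (hS : 1 ≤ S) (k : Fin K) :
    Fintype.card {V : UserGroup K S // k ∈ V.1} = (K - 1).choose (S - 1) := by
  have hmem (T : (Finset.univ.erase k).powersetCard (S - 1)) : k ∉ T.1 := fun h =>
    Finset.notMem_erase k _ ((Finset.mem_powersetCard.1 T.2).1 h)
  let e : {V : UserGroup K S // k ∈ V.1} ≃ (Finset.univ.erase k).powersetCard (S - 1) :=
    { toFun V := ⟨V.1.1.erase k, Finset.mem_powersetCard.2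
        ⟨Finset.erase_subset_erase _ (Finset.subset_univ _), by
          rw [Finset.card_erase_of_mem V.2, V.1.2]⟩⟩
      invFun T := ⟨⟨insert k T.1, by
          rw [Finset.card_insert_of_notMem (hmem T), (Finset.mem_powersetCard.1 T.2).2]
          omega⟩, Finset.mem_insert_self _ _⟩
      left_inv V := Subtype.ext (Subtype.ext (Finset.insert_erase V.2))
      right_inv T := Subtype.ext (Finset.erase_insert (hmem T)) }
  rw [Fintype.card_congr e, Fintype.card_coe, Finset.card_powersetCard,
    Finset.card_erase_of_mem (Finset.mem_univ k), Finset.card_univ, Fintype.card_fin]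

namespace LinearCode

section Code

variable {F : Type*} [Field F] {K U S : ℕ} {W P C : Type*} [AddCommGroup W] [Module F W]
  [AddCommGroup P] [Module F P] [AddCommGroup C] [Module F C]

/-- The code whose shares carry additional symbols in `E`, all equal to zero. Masking turns them
into random symbols, which only increase the rate of the first round. -/
def pad (c : LinearCode F K U S W P C) (E : Type*) [AddCommGroup E] [Module F E] :
    LinearCode F K U S W (P × E) C where
  share k V := LinearMap.inl F P E ∘ₗ c.share k V
  combine := c.combine
  recover j k V := c.recover j k V ∘ₗ LinearMap.fst F P E
  combine_eq j k hjk w := by simp [c.combine_eq j k hjk w]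
  eq_zero := c.eq_zero

lemma combine_surjective [FiniteDimensional F W] [FiniteDimensional F C]
    (c : LinearCode F K U S W P C) (hW : finrank F W = U * finrank F C) (hU : 1 ≤ U)
    (hUK : U ≤ K) (j : Fin K) : Function.Surjective (c.combine j) := by
  obtain ⟨U₂, hj, -, hU₂⟩ := Finset.exists_subsuperset_card_eq (Finset.subset_univ {j})
    (by simpa using hU) (n := U) (by simpa using hUK)
  let φ : W →ₗ[F] (U₂ → C) := LinearMap.pi fun i => c.combine i
  have hinj : Function.Injective φ := (injective_iff_map_eq_zero φ).2 fun w hw =>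
    c.eq_zero U₂ hU₂.ge w fun i hi => congrFun hw ⟨i, hi⟩
  have hsurj : Function.Surjective φ :=
    (LinearMap.injective_iff_surjective_of_finrank_eq_finrank
      (by simp [finrank_pi_fintype, hU₂, hW])).1 hinj
  intro y
  obtain ⟨w, hw⟩ := hsurj fun _ => y
  exact ⟨w, congrFun hw ⟨j, Finset.singleton_subset_iff.1 hj⟩⟩

end Code

section Messages

variable {F : Type*} [Field F] {K U S : ℕ} {W P C E : Type*} [AddCommGroup W] [Module F W]
  [AddCommGroup P] [Module F P] [AddCommGroup C] [Module F C] [AddCommGroup E] [Module F E]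

/-- The sample space: an input in `W` for each user, and in the key of each group, for each user,
a mask in `P` for the first round and padding in `E` for the second. -/
abbrev Sample (K S : ℕ) (W P E : Type*) : Type _ :=
  (Fin K → W) × (UserGroup K S → Fin K → P × E)

variable (c : LinearCode F K U S W P C)

variable (E) in
/-- First-round message of user `k`: the shares of its input, masked. -/
def msg₁ (k : Fin K) : Sample K S W P E →ₗ[F] {V : UserGroup K S // k ∈ V.1} → P where
  toFun ω V := c.share k V (ω.1 k) + (ω.2 V.1 k).1
  map_add' ω ω' := funext fun V => by simp [add_add_add_comm]
  map_smul' a ω := funext fun V => by simp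

/-- The padding available to user `j` for the second round. -/
def padding (F : Type*) [Field F] (W P : Type*) {E : Type*} [AddCommGroup W] [Module F W]
    [AddCommGroup P] [Module F P] [AddCommGroup E] [Module F E] {K S : ℕ} (j : Fin K) :
    Sample K S W P E →ₗ[F] {V : UserGroup K S // j ∈ V.1} → E where
  toFun ω V := (ω.2 V.1 j).2
  map_add' _ _ := rfl
  map_smul' _ _ := rfl

variable (E) in
/-- What user `j` contributes to the combination `c.combine j` of the sum over `U₁`: its own input,
and the cancellation of the masks of the other users. -/
def reveal (U₁ : Finset (Fin K)) (j : Fin K) : Sample K S W P E →ₗ[F] C where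
  toFun ω := c.combine j (ω.1 j) -
    ∑ k ∈ U₁.erase j, ∑ V : {V : UserGroup K S // k ∈ V.1} with j ∈ V.1.1,
      c.recover j k V (ω.2 V.1 k).1
  map_add' ω ω' := by
    simp only [Prod.fst_add, Prod.snd_add, Pi.add_apply, map_add, Finset.sum_add_distrib,
      add_sub_add_comm]
  map_smul' a ω := by
    simp only [Prod.smul_fst, Prod.smul_snd, Pi.smul_apply, map_smul, Finset.smul_sum, smul_sub,
      RingHom.id_apply]

variable (E) in
/-- Second-round message of user `j`. -/
def msg₂ (U₁ : Finset (Fin K)) (j : Fin K) :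
    Sample K S W P E →ₗ[F] C × ({V : UserGroup K S // j ∈ V.1} → E) :=
  (c.reveal E U₁ j).prod (padding F W P j)

lemma combine_sum_inputs {U₁ : Finset (Fin K)} {j : Fin K} (hj : j ∈ U₁) (ω : Sample K S W P E) :
    c.combine j (∑ k ∈ U₁, ω.1 k) = c.reveal E U₁ j ω +
      ∑ k ∈ U₁.erase j, ∑ V : {V : UserGroup K S // k ∈ V.1} with j ∈ V.1.1,
        c.recover j k V (c.msg₁ E k ω V) := by
  have hcombine : ∀ k ∈ U₁.erase j, ∑ V : {V : UserGroup K S // k ∈ V.1} with j ∈ V.1.1,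
      c.recover j k V (c.msg₁ E k ω V) = c.combine j (ω.1 k) +
        ∑ V : {V : UserGroup K S // k ∈ V.1} with j ∈ V.1.1, c.recover j k V (ω.2 V.1 k).1 := by
    intro k hk
    rw [c.combine_eq j k (Finset.ne_of_mem_erase hk).symm, ← Finset.sum_add_distrib]
    exact Finset.sum_congr rfl fun V _ => map_add _ _ _
  rw [Finset.sum_congr rfl hcombine, Finset.sum_add_distrib, ← Finset.add_sum_erase _ _ hj,
    map_add, map_sum]
  simp only [reveal, LinearMap.coe_mk, AddHom.coe_mk]
  abel

lemma reveal_eq_of_msg₁_eq {U₁ : Finset (Fin K)} {j : Fin K} (hj : j ∈ U₁)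
    {ω ω' : Sample K S W P E} (hmsg : ∀ k ∈ U₁, c.msg₁ E k ω = c.msg₁ E k ω') :
    c.reveal E U₁ j ω = c.reveal E U₁ j ω' ↔
      c.combine j (∑ k ∈ U₁, ω.1 k) = c.combine j (∑ k ∈ U₁, ω'.1 k) := by
  rw [c.combine_sum_inputs hj, c.combine_sum_inputs hj,
    Finset.sum_congr rfl fun k hk => by rw [hmsg k (Finset.mem_of_mem_erase hk)], add_left_inj]

/-- The part of the messages that is independent of the inputs. -/
def blinded (U₁ : Finset (Fin K)) : Sample K S W P E →ₗ[F]
    (∀ k, {V : UserGroup K S // k ∈ V.1} → P) × ∀ j : U₁, {V : UserGroup K S // j.1 ∈ V.1} → E :=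
  (LinearMap.pi (c.msg₁ E)).prod (LinearMap.pi fun j : U₁ => padding F W P j.1)

lemma inputs_prod_blinded_surjective (U₁ : Finset (Fin K)) :
    Function.Surjective ((LinearMap.fst F (Fin K → W) _).prod (c.blinded (E := E) U₁)) := by
  classical
  rintro ⟨w, x, z⟩
  refine ⟨(w, fun V k => (if h : k ∈ V.1 then x k ⟨V, h⟩ - c.share k ⟨V, h⟩ (w k) else 0,
    if h : k ∈ U₁ ∧ k ∈ V.1 then z ⟨k, h.1⟩ ⟨V, h.2⟩ else 0)), ?_⟩
  refine Prod.ext rfl (Prod.ext (funext₂ fun k V => ?_) (funext₂ fun j V => ?_))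
  · simp [blinded, msg₁, V.2]
  · simp [blinded, padding, V.2]

end Messages

end LinearCode

namespace LinearCode

open ProbabilityTheory

variable {F : Type u} [Field F] [Fintype F] {K U S L : ℕ} {P C E : Type u}
  [AddCommGroup P] [Module F P] [Fintype P] [AddCommGroup C] [Module F C] [Fintype C]
  [AddCommGroup E] [Module F E] [Fintype E] (c : LinearCode F K U S (Fin L → F) P C)

local instance : MeasurableSpace (Sample K S (Fin L → F) P E) := ⊤

local instance : DiscreteMeasurableSpace (Sample K S (Fin L → F) P E) := ⟨fun _ => trivial⟩

variable (E) in
/-- The aggregation scheme of a linear code. -/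
noncomputable def scheme : Scheme K S L F where
  Ω := Sample K S (Fin L → F) P E
  μ := uniformOn Set.univ
  probμ := isProbabilityMeasure_uniformOn Set.finite_univ Set.univ_nonempty
  Key _ := Fin K → P × E
  Msg₁ k := {V : UserGroup K S // k ∈ V.1} → P
  Msg₂ _ j := C × ({V : UserGroup K S // j ∈ V.1} → E)
  W k ω := ω.1 k
  Z V ω := ω.2 V
  X k := c.msg₁ E k
  Y U₁ j := c.msg₂ E U₁ j
  measurable_W _ := fun _ _ => trivial
  measurable_Z _ := fun _ _ => trivial
  measurable_X _ := fun _ _ => trivial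
  measurable_Y _ _ := fun _ _ => trivial

instance : DiscreteMeasurableSpace (c.scheme E).Ω := ⟨fun _ => trivial⟩

variable (E) in
lemma H_scheme_eq_finrank {M : Type*} [AddCommGroup M] [Module F M] [Fintype M]
    {A : Sample K S (Fin L → F) P E →ₗ[F] M} (hA : Function.Surjective A) :
    (c.scheme E).H A = finrank F M :=
  entropy_uniformOn_eq_finrank hA

lemma H_scheme_input (k : Fin K) : (c.scheme E).H ((c.scheme E).W k) = L := by
  let A : Sample K S (Fin L → F) P E →ₗ[F] (Fin L → F) := LinearMap.proj k ∘ₗ LinearMap.fst F _ _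
  have hA : Function.Surjective A := fun w => ⟨(fun _ => w, 0), rfl⟩
  exact (c.H_scheme_eq_finrank E hA).trans (by simp)

lemma H_scheme_key (V : UserGroup K S) :
    (c.scheme E).H ((c.scheme E).Z V) = finrank F (Fin K → P × E) := by
  let A : Sample K S (Fin L → F) P E →ₗ[F] (Fin K → P × E) :=
    LinearMap.proj V ∘ₗ LinearMap.snd F (Fin K → Fin L → F) (UserGroup K S → Fin K → P × E)
  have hA : Function.Surjective A := fun z => ⟨(0, fun _ => z), rfl⟩
  have hH : (c.scheme E).H A = finrank F (Fin K → P × E) := c.H_scheme_eq_finrank E hA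
  exact hH

lemma H_scheme_msg₁ (hS : 1 ≤ S) (k : Fin K) :
    (c.scheme E).H ((c.scheme E).X k) = (K - 1).choose (S - 1) * finrank F P := by
  refine (c.H_scheme_eq_finrank E (A := c.msg₁ E k) fun x => ?_).trans ?_
  · obtain ⟨ω, hω⟩ := c.inputs_prod_blinded_surjective (E := E) ∅ (0, Function.update 0 k x, 0)
    have hmsg : c.msg₁ E k ω = Function.update (0 : ∀ k : Fin K, {V : UserGroup K S // k ∈ V.1} → P)
        k x k := congrFun (congrArg Prod.fst (Prod.mk.inj hω).2) k
    exact ⟨ω, hmsg.trans (Function.update_self ..)⟩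
  · simp [finrank_pi_fintype, card_groups_of_mem hS]

lemma H_scheme_msg₂ (hL : L = U * finrank F C) (hU : 1 ≤ U) (hUK : U ≤ K) (hS : 1 ≤ S)
    (U₁ : Finset (Fin K)) (j : Fin K) : (c.scheme E).H ((c.scheme E).Y U₁ j) =
      finrank F C + (K - 1).choose (S - 1) * finrank F E := by
  refine (c.H_scheme_eq_finrank E (A := c.msg₂ E U₁ j) fun y => ?_).trans ?_
  · obtain ⟨w, hw⟩ := c.combine_surjective (by simpa using hL) hU hUK j y.1
    refine ⟨(fun _ => w, fun V _ => (0, if h : j ∈ V.1 then y.2 ⟨V, h⟩ else 0)), ?_⟩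
    refine Prod.ext ?_ (funext fun V => ?_)
    · simp [msg₂, reveal, hw]
    · simp [msg₂, padding, V.2]
  · simp [finrank_prod, finrank_pi_fintype, card_groups_of_mem hS]

lemma uniformInputs_scheme : (c.scheme E).UniformInputs := by
  intro k w
  let A : Sample K S (Fin L → F) P E →ₗ[F] (Fin L → F) := LinearMap.proj k ∘ₗ LinearMap.fst F _ _
  exact (uniformOn_real_preimage_singleton (A := A.toAddMonoidHom)
    (fun w => ⟨(fun _ => w, 0), rfl⟩) w).trans (by simp)

lemma independentKeys_scheme : (c.scheme E).IndependentKeys := by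
  have hall : (c.scheme E).H (fun ω => ((fun V => (c.scheme E).Z V ω),
      fun k => (c.scheme E).W k ω)) =
        finrank F ((UserGroup K S → Fin K → P × E) × (Fin K → Fin L → F)) :=
    c.H_scheme_eq_finrank E (A := (LinearMap.snd F _ _).prod (LinearMap.fst F _ _))
      fun z => ⟨(z.2, z.1), rfl⟩
  unfold Scheme.IndependentKeys
  rw [hall, Finset.sum_congr rfl fun V _ => c.H_scheme_key V,
    Finset.sum_congr rfl fun k _ => c.H_scheme_input k, finrank_prod, finrank_pi_fintype,
    finrank_pi_fintype, finrank_pi_fintype]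
  simp

lemma firstRoundEncoding_scheme : (c.scheme E).FirstRoundEncoding := by
  refine fun k => condEntropy_eq_zero_of_factorsThrough Scheme.one_le_card fun ω ω' e => ?_
  obtain ⟨hinput, hkeys⟩ := Prod.mk.inj e
  refine funext fun V => ?_
  change c.share k V (ω.1 k) + (ω.2 V.1 k).1 = c.share k V (ω'.1 k) + (ω'.2 V.1 k).1
  rw [show ω.1 k = ω'.1 k from hinput, show ω.2 V.1 = ω'.2 V.1 from congrFun hkeys V]

lemma secondRoundEncoding_scheme : (c.scheme E).SecondRoundEncoding U := by
  refine fun U₁ _ j _ =>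
    condEntropy_eq_zero_of_factorsThrough Scheme.one_le_card fun ω ω' e => ?_
  obtain ⟨hinput, hkeys⟩ := Prod.mk.inj e
  replace hinput : ω.1 j = ω'.1 j := hinput
  have hkey (V : UserGroup K S) (hV : j ∈ V.1) : ω.2 V = ω'.2 V := congrFun hkeys ⟨V, hV⟩
  refine Prod.ext ?_ (funext fun V => ?_)
  · change c.combine j (ω.1 j) - _ = c.combine j (ω'.1 j) - _
    rw [hinput]
    congr 1
    refine Finset.sum_congr rfl fun k _ => Finset.sum_congr rfl fun V hV => ?_
    rw [hkey V.1 (Finset.mem_filter.1 hV).2]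
  · change (ω.2 V.1 j).2 = (ω'.2 V.1 j).2
    rw [hkey V.1 V.2]

lemma decodable_scheme : (c.scheme E).Decodable U := by
  refine fun U₁ U₂ hsub hU₂ =>
    condEntropy_eq_zero_of_factorsThrough Scheme.one_le_card fun ω ω' e => ?_
  obtain ⟨hX, hY⟩ := Prod.mk.inj e
  have hreveal (j : Fin K) (hj : j ∈ U₂) : c.reveal E U₁ j ω = c.reveal E U₁ j ω' :=
    congrArg Prod.fst (congrFun hY ⟨j, hj⟩)
  change ∑ k ∈ U₁, ω.1 k = ∑ k ∈ U₁, ω'.1 k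
  refine sub_eq_zero.1 (c.eq_zero U₂ hU₂ _ fun j hj => ?_)
  rw [map_sub, sub_eq_zero,
    ← c.reveal_eq_of_msg₁_eq (E := E) (hsub hj) fun k hk => congrFun hX ⟨k, hk⟩]
  exact hreveal j hj

lemma secure_scheme : (c.scheme E).Secure U := by
  intro U₁ _
  have hindep : EntropyIndep (Fintype.card F) (c.scheme E).μ
      (LinearMap.fst F (Fin K → Fin L → F) (UserGroup K S → Fin K → P × E))
      (c.blinded (E := E) U₁) :=
    entropyIndep_uniformOn (c.inputs_prod_blinded_surjective U₁)
  refine condMutualInfo_eq_zero_of_entropyIndep Scheme.one_le_card hindep ?_ ?_ ?_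
  · exact fun ω ω' e => Finset.sum_congr rfl fun k _ => congrFun e k
  · intro ω ω' e
    obtain ⟨hX, hY⟩ := Prod.mk.inj e
    exact Prod.ext hX (funext fun j => congrArg Prod.snd (congrFun hY j))
  · intro ω ω' e
    obtain ⟨hblinded, hsum⟩ := Prod.mk.inj e
    obtain ⟨hmsg, hpadding⟩ := Prod.mk.inj hblinded
    refine Prod.ext hmsg (funext fun j => Prod.ext ?_ (congrFun hpadding j))
    exact (c.reveal_eq_of_msg₁_eq j.2 fun k _ => congrFun hmsg k).2 (congrArg (c.combine j) hsum)

theorem isSecureAggregation_scheme : (c.scheme E).IsSecureAggregation U :=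
  ⟨c.uniformInputs_scheme, c.independentKeys_scheme, c.firstRoundEncoding_scheme,
    c.secondRoundEncoding_scheme, c.decodable_scheme, c.secure_scheme⟩

end LinearCode

/-! ### The capacity region -/

lemma choose_lt_choose_of_lt {r n s : ℕ} (hs : s ≠ 0) (hsn : s ≤ n) (hrn : r < n) :
    r.choose s < n.choose s := by
  obtain ⟨t, rfl⟩ := Nat.exists_eq_succ_of_ne_zero hs
  obtain ⟨n, rfl⟩ := Nat.exists_eq_succ_of_ne_zero (Nat.ne_zero_of_lt hrn)
  calc r.choose (t + 1) ≤ n.choose (t + 1) := Nat.choose_le_choose _ (Nat.le_of_lt_succ hrn)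
    _ < n.choose t + n.choose (t + 1) :=
      Nat.lt_add_of_pos_left (Nat.choose_pos (Nat.le_of_succ_le_succ hsn))
    _ = (n + 1).choose (t + 1) := (Nat.choose_succ_succ' n t).symm

lemma sub_choose_pos {K U S : ℕ} (hU : 1 ≤ U) (hUK : U < K) (hS : 2 ≤ S) (hSK : S ≤ K) :
    (0 : ℝ) < (K - 1).choose (S - 1) - (K - 1 - U).choose (S - 1) :=
  sub_pos.2 (by exact_mod_cast choose_lt_choose_of_lt (by omega) (by omega) (by omega))

theorem not_possible_of_singleton_groups {F : Type u} [Field F] [Fintype F] {K U : ℕ}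
    (hU : 1 ≤ U) (hUK : U < K) : ¬ Possible K U 1 F := by
  rintro ⟨L, hL, 𝒮, h⟩
  have hbound := Scheme.choose_mul_le_sub_mul_H_msg₁ h hU hUK le_rfl (by omega) ⟨0, by omega⟩
  have hL_nonpos : (L : ℝ) ≤ 0 := by simpa using hbound
  exact hL.not_ge (by exact_mod_cast hL_nonpos)

namespace Scheme

variable {F : Type u} [Field F] [Fintype F] {K U S L : ℕ} {𝒮 : Scheme K S L F}

theorem le_rate₁ (h : 𝒮.IsSecureAggregation U) (hL : 0 < L) (hU : 1 ≤ U) (hUK : U < K)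
    (hS : 2 ≤ S) (hSK : S ≤ K) :
    ((K - 1).choose (S - 1) : ℝ) /
      (((K - 1).choose (S - 1) : ℝ) - ((K - 1 - U).choose (S - 1) : ℝ)) ≤ 𝒮.rate₁ := by
  let k : Fin K := ⟨0, by omega⟩
  have hk : 𝒮.H (𝒮.X k) / L ≤ 𝒮.rate₁ :=
    le_ciSup (f := fun k => 𝒮.H (𝒮.X k) / L) (Finite.bddAbove_range _) k
  refine le_trans ?_ hk
  rw [div_le_div_iff₀ (sub_choose_pos hU hUK hS hSK) (by exact_mod_cast hL), mul_comm (𝒮.H _)]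
  exact choose_mul_le_sub_mul_H_msg₁ h hU hUK (by omega) hSK k

theorem le_rate₂ (h : 𝒮.IsSecureAggregation U) (hL : 0 < L) (hU : 1 ≤ U) (hUK : U < K) :
    1 / (U : ℝ) ≤ 𝒮.rate₂ U := by
  have hLR : (0 : ℝ) < L := by exact_mod_cast hL
  obtain ⟨U₁, -, hU₁⟩ := Finset.exists_subset_card_eq
    (s := (Finset.univ : Finset (Fin K))) (n := U) (by simpa using hUK.le)
  have hle : ∀ k ∈ U₁, 𝒮.H (𝒮.Y U₁ k) ≤ 𝒮.rate₂ U * L := fun k hk => (div_le_iff₀ hLR).1 <|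
    le_ciSup (f := fun p : {p : Finset (Fin K) × Fin K // U ≤ p.1.card ∧ p.2 ∈ p.1} =>
      𝒮.H (𝒮.Y p.1.1 p.1.2) / L) (Finite.bddAbove_range _) ⟨(U₁, k), hU₁.ge, hk⟩
  have hsum : (L : ℝ) ≤ U * (𝒮.rate₂ U * L) := by
    calc (L : ℝ) ≤ ∑ k ∈ U₁, 𝒮.H (𝒮.Y U₁ k) := le_sum_H_msg₂ h hU hU₁ hUK
      _ ≤ U₁.card • (𝒮.rate₂ U * L) := Finset.sum_le_card_nsmul _ _ _ hle
      _ = U * (𝒮.rate₂ U * L) := by rw [hU₁, nsmul_eq_mul]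
  rw [div_le_iff₀ (by exact_mod_cast hU)]
  refine le_of_mul_le_mul_right ?_ hLR
  linarith

end Scheme

/-- `e₁` and `e₂` are the numbers of symbols of padding added in the two rounds, per user and
group. -/
theorem exists_achievable (F : Type u) [Field F] [Fintype F] {K U S : ℕ} (hU : 1 ≤ U)
    (hUK : U < K) (hS : 2 ≤ S) (hSK : S ≤ K) (L₀ : ℕ) :
    ∃ L : ℕ, 0 < L ∧ L₀ ≤ L ∧ ∀ e₁ e₂ : ℕ, Achievable K U S F
      (((K - 1).choose (S - 1) : ℝ) /
        (((K - 1).choose (S - 1) : ℝ) - ((K - 1 - U).choose (S - 1) : ℝ)) +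
          e₁ * ((K - 1).choose (S - 1) / L),
        1 / (U : ℝ) + e₂ * ((K - 1).choose (S - 1) / L)) := by
  obtain ⟨m, hm, ⟨c⟩⟩ := exists_linearCode F hU hUK hS (L₀ + 1)
  have hlt : (K - 1 - U).choose (S - 1) < (K - 1).choose (S - 1) :=
    choose_lt_choose_of_lt (by omega) (by omega) (by omega)
  rw [← Nat.cast_sub hlt.le]
  set d := (K - 1).choose (S - 1) - (K - 1 - U).choose (S - 1)
  have hd : 0 < d := Nat.sub_pos_of_lt hlt
  have hm₀ : 0 < m := by omega
  refine ⟨d * (U * m), by positivity, ?_, fun e₁ e₂ => ⟨d * (U * m), by positivity,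
    (c.pad (Fin e₁ → F)).scheme (Fin e₂ → F), LinearCode.isSecureAggregation_scheme _, ?_, ?_⟩⟩
  · calc L₀ ≤ m := by omega
      _ ≤ U * m := Nat.le_mul_of_pos_left _ hU
      _ ≤ d * (U * m) := Nat.le_mul_of_pos_left _ hd
  · have : Nonempty (Fin K) := ⟨⟨0, by omega⟩⟩
    simp only [Scheme.rate₁, LinearCode.H_scheme_msg₁ _ (show 1 ≤ S by omega), ciSup_const,
      finrank_prod, finrank_fin_fun]
    push_cast
    field_simp
  · have : Nonempty {p : Finset (Fin K) × Fin K // U ≤ p.1.card ∧ p.2 ∈ p.1} :=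
      ⟨⟨(Finset.univ, ⟨0, by omega⟩), by simpa using hUK.le, Finset.mem_univ _⟩⟩
    have hL : d * (U * m) = U * finrank F (Fin (d * m) → F) := by
      rw [finrank_fin_fun]
      ring
    simp only [Scheme.rate₂, LinearCode.H_scheme_msg₂ _ hL hU hUK.le (show 1 ≤ S by omega),
      ciSup_const, finrank_fin_fun]
    push_cast
    field_simp

lemma exists_nat_abs_sub_lt {a b δ ε : ℝ} (hab : a ≤ b) (hδ : 0 < δ) (hδε : δ < ε) :
    ∃ e : ℕ, |b - (a + e * δ)| < ε := by
  refine ⟨⌊(b - a) / δ⌋₊, ?_⟩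
  have hfloor := (le_div_iff₀ hδ).1 (Nat.floor_le (div_nonneg (sub_nonneg.2 hab) hδ.le))
  have hceil := (div_lt_iff₀ hδ).1 (Nat.lt_floor_add_one ((b - a) / δ))
  rw [abs_lt]
  constructor <;> linarith

theorem mem_capacityRegion {F : Type u} [Field F] [Fintype F] {K U S : ℕ} (hU : 1 ≤ U)
    (hUK : U < K) (hS : 2 ≤ S) (hSK : S ≤ K) {R : ℝ × ℝ}
    (h₁ : ((K - 1).choose (S - 1) : ℝ) /
      (((K - 1).choose (S - 1) : ℝ) - ((K - 1 - U).choose (S - 1) : ℝ)) ≤ R.1)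
    (h₂ : 1 / (U : ℝ) ≤ R.2) : R ∈ capacityRegion K U S F := by
  refine Metric.mem_closure_iff.2 fun ε hε => ?_
  obtain ⟨L₀, hL₀⟩ := exists_nat_gt ((K - 1).choose (S - 1) / ε)
  obtain ⟨L, hL, hLL, hach⟩ := exists_achievable F hU hUK hS hSK L₀
  have hLR : (0 : ℝ) < L := by exact_mod_cast hL
  have hstep : (0 : ℝ) < (K - 1).choose (S - 1) / L :=
    div_pos (by exact_mod_cast Nat.choose_pos (by omega)) hLR
  have hsmall : (K - 1).choose (S - 1) / L < ε := by
    rw [div_lt_comm₀ hLR hε]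
    exact hL₀.trans_le (by exact_mod_cast hLL)
  obtain ⟨e₁, he₁⟩ := exists_nat_abs_sub_lt h₁ hstep hsmall
  obtain ⟨e₂, he₂⟩ := exists_nat_abs_sub_lt h₂ hstep hsmall
  exact ⟨_, hach e₁ e₂, max_lt he₁ he₂⟩

end SecureAggregation

theorem theorem4 {F : Type*} [Field F] [Fintype F] (K U S : ℕ)
    (hU : 1 ≤ U) (hUK : U < K) (hSK : S ≤ K) :
    (S = 1 → ¬ SecureAggregation.Possible K U S F) ∧
    (2 ≤ S →
      SecureAggregation.capacityRegion K U S F =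
        {R : ℝ × ℝ |
          ((K - 1).choose (S - 1) : ℝ) /
              (((K - 1).choose (S - 1) : ℝ) - ((K - 1 - U).choose (S - 1) : ℝ)) ≤ R.1 ∧
          1 / (U : ℝ) ≤ R.2}) := by
  refine ⟨?_, fun hS => Set.Subset.antisymm (closure_minimal ?_ ?_) ?_⟩
  · rintro rfl
    exact SecureAggregation.not_possible_of_singleton_groups hU hUK
  · rintro R ⟨L, hL, 𝒮, h, h₁, h₂⟩
    exact ⟨(SecureAggregation.Scheme.le_rate₁ h hL hU hUK hS hSK).trans_eq h₁.symm,
      (SecureAggregation.Scheme.le_rate₂ h hL hU hUK).trans_eq h₂.symm⟩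
  · exact (isClosed_le continuous_const continuous_fst).inter
      (isClosed_le continuous_const continuous_snd)
  · rintro R ⟨h₁, h₂⟩
    exact SecureAggregation.mem_capacityRegion hU hUK hS hSK h₁ h₂
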